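/- Let $\mathcal M$ be a non-empty finite set, $\mathcal H$ a two-dimensional complex Hilbert space, $\mathcal G\subseteq\mathcal S_{\mathcal M}$ a permutation group, and $\boldsymbol\sigma$ a channel assigning to each $m\in\mathcal M$ a density operator $\boldsymbol\sigma(m)$ on $\mathcal H$. Let $\gamma:\{1,\dots,|\mathcal M|\}\to\mathbb R$ be non-increasing and balanced, i.e. $\gamma(t)+\gamma(|\mathcal M|+1-t)$ does not depend on $t$; let $\overline\gamma$ be its average and $\gamma_0=\gamma-\overline\gamma$. *Symmetry.* A statistical morphism of $\boldsymbol\sigma$ is a linear, positivity-preserving map $R$ on operators such that for every finite measurement $\boldsymbol\pi$ there is a measurement $\boldsymbol\tau$ with $\mathrm{Tr}[\boldsymbol\pi(x)R(\boldsymbol\sigma(m))]=\mathrm{Tr}[\boldsymbol\tau(x)\boldsymbol\sigma(m)]$ for all $x,m$. Assume $\boldsymbol\sigma$ is $\mathcal G$-covariant: there is a linear representation $g\mapsto R_g$ of $\mathcal G$ on operators by statistical morphisms with $R_g\circ\boldsymbol\sigma=\boldsymbol\sigma\circ g$. Call $\mathcal G$ transitive if some such representation acts transitively on $\boldsymbol\sigma(\mathcal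 M)$, and $\boldsymbol\sigma$ centrally symmetric (CS) if for some such representation and some $g\in\mathcal G$ one has $R_g(\rho)=\mathbb 1-\rho$ for all density operators $\rho$. An antipodal pairing is an involution $m\mapsto\overline m$ of $\mathcal M$ with $\boldsymbol\sigma(m)+\boldsymbol\sigma(\overline m)=\mathbb 1$ and at most one fixed point (for injective CS $\boldsymbol\sigma$ it is the action of $g$). *Guesswork.* A numbering is a bijection $\mathbf n:\{1,\dots,|\mathcal M|\}\to\mathcal M$. The minimum guesswork for the uniform prior, $G^\gamma_{\min}(|\mathcal M|^{-1},\boldsymbol\sigma)$, is the minimum of $\sum_{\mathbf n,t}|\mathcal M|^{-1}\mathrm{Tr}[\boldsymbol\sigma(\mathbf n(t))\boldsymbol\pi(\mathbf n)]\gamma(t)$ over all numbering-valued measurements $\boldsymbol\pi$. *Algorithm.* Let $E(\mathbf n)=\frac{2}{|\mathcal M|}\sum_t\gamma_0(t)\boldsymbol\sigma(\mathbf n(t))$ and let $\|\cdot\|$ be the trace norm. The branch-and-bound algorithm maximizes $\|E(\mathbf n)\|$ over a feasible set of numberings. The feasible set consists of all numberings; with $k=1$ (CS mode; otherwise $k=0$),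 only of those with $\mathbf n(|\mathcal M|+1-t)=\overline{\mathbf n(t)}$ for all $t$; with $j=1$ (transitive mode; otherwise $j=0$), only of those with $\mathbf n(1)=m$ for a chosen letter $m$. The algorithm keeps a pool of subsets still to be explored (initially just the feasible set) and the best numbering evaluated so far. For a subset $\mathcal N$ let $t^*-1$ be the length of the longest common prefix of its numberings. Branching splits $\mathcal N$ according to the letter $\mathbf n(t^*)$, among the letters not used at the times $t<t^*$ (nor, if $k=1$, at $|\mathcal M|+1-t$ with $t<t^*$). The bound of $\mathcal N$ is $$(k+1)\Bigl(\Bigl\|\sum_{t<t^*}\gamma_0(t)\boldsymbol\sigma(\mathbf n(t))\Bigr\|+\sum_{t^*\le t\le|\mathcal M|/2^k}|\gamma_0(t)|\Bigr),\qquad \mathbf n\in\mathcal N;$$ $\mathcal N$ is pruned if its bound does not exceed the best objective value found so far. Subsets that are neither single numberings (leaves) nor pruned are branched. In one unit of time each of the $C\ge1$ computing units disposes of one subset of the pool, evaluating the objective at a leaf or discarding a pruned subset; a unit idles only when the pool is thereby exhausted. Generating branches is not charged. **Theorem.** For every order of selecting subsets, the algorithm terminates with a numbering $\mathbf n^*$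 such that $$G^\gamma_{\min}(|\mathcal M|^{-1},\boldsymbol\sigma)=\overline\gamma-\tfrac12\|E(\mathbf n^*)\|,$$ exactly, in time $T_C\le\lceil W/C\rceil$ and after fewer than $W$ branchings, where - $W=|\mathcal M|!$ for $j=k=0$, in general; - $W=(|\mathcal M|-1)!$ for $j=1$, $k=0$ and any $m\in\mathcal M$, if $\mathcal G$ is transitive; - $W=|\mathcal M|!!$ for $j=0$, $k=1$, if $\boldsymbol\sigma$ is CS; antipodal pairings then exist and any of them may be used; - $W=(|\mathcal M|-2)!!$ for $j=k=1$, any antipodal pairing and any $m$ with $\overline m\neq m$, if $\mathcal G$ is transitive and $\boldsymbol\sigma$ is CS; then $|\mathcal M|\ge2$, and every $m$ qualifies if $|\mathcal M|$ is even. -/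

import Mathlib

namespace Guesswork

noncomputable section

/-- Numberings of a finite set `M`: bijections from the query times to `M`.
Time `t ∈ {1, …, |M|}` is represented by the index `t - 1 : Fin |M|`, so that
`|M| + 1 - t` is represented by `Fin.rev`. -/
abbrev Numbering (M : Type*) [Fintype M] : Type _ := Fin (Fintype.card M) ≃ M

section Operators

variable {H : Type*} [NormedAddCommGroup H] [InnerProductSpace ℂ H]

/-- Trace of an operator. -/
def tr (A : H →ₗ[ℂ] H) : ℂ := LinearMap.trace ℂ H A

/-- Trace norm: the sum of the singular values. -/
def traceNorm [FiniteDimensional ℂ H] (A : H →ₗ[ℂ] H) : ℝ :=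
  ∑ i ∈ Finset.range (Module.finrank ℂ H), A.singularValues i

/-- Density operators (states). -/
def IsState (ρ : H →ₗ[ℂ] H) : Prop := ρ.IsPositive ∧ tr ρ = 1

/-- Classical-quantum channels with input alphabet `M`. -/
def IsCQChannel {M : Type*} (σ : M → (H →ₗ[ℂ] H)) : Prop := ∀ m, IsState (σ m)

/-- Measurements with outcomes in a finite set. -/
def IsMeasurement {X : Type*} [Fintype X] (π : X → (H →ₗ[ℂ] H)) : Prop :=
  (∀ x, (π x).IsPositive) ∧ ∑ x, π x = LinearMap.id

/-- Statistical morphisms of the channel `σ`. -/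
def IsStatisticalMorphism {M : Type*} (σ : M → (H →ₗ[ℂ] H))
    (R : (H →ₗ[ℂ] H) →ₗ[ℂ] (H →ₗ[ℂ] H)) : Prop :=
  (∀ A : H →ₗ[ℂ] H, A.IsPositive → (R A).IsPositive) ∧
  ∀ (k : ℕ) (π : Fin k → (H →ₗ[ℂ] H)), IsMeasurement π →
    ∃ τ : Fin k → (H →ₗ[ℂ] H), IsMeasurement τ ∧
      ∀ m x, tr (π x ∘ₗ R (σ m)) = tr (τ x ∘ₗ σ m)

/-- `R` is a representation of `G` by statistical morphisms of `σ` that makes `σ` covariant. -/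
def IsCovariantRep {M : Type*} (G : Subgroup (Equiv.Perm M)) (σ : M → (H →ₗ[ℂ] H))
    (R : Representation ℂ G (H →ₗ[ℂ] H)) : Prop :=
  ∀ g : G, IsStatisticalMorphism σ (R g) ∧ ∀ m, R g (σ m) = σ ((g : Equiv.Perm M) m)

/-- `σ` is `G`-covariant. -/
def IsCovariant {M : Type*} (G : Subgroup (Equiv.Perm M)) (σ : M → (H →ₗ[ℂ] H)) : Prop :=
  ∃ R : Representation ℂ G (H →ₗ[ℂ] H), IsCovariantRep G σ R

/-- `G` is transitive for `σ`: some covariant representation acts transitively on the states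
of `σ`. -/
def IsTransitive {M : Type*} (G : Subgroup (Equiv.Perm M)) (σ : M → (H →ₗ[ℂ] H)) : Prop :=
  ∃ R : Representation ℂ G (H →ₗ[ℂ] H), IsCovariantRep G σ R ∧
    ∀ m m', ∃ g : G, R g (σ m) = σ m'

/-- `σ` is centrally symmetric: for some covariant representation and some `g ∈ G`, the morphism
`R g` maps each state `ρ` to `2 / d • 1 - ρ`, where `d` is the dimension of `H`. -/
def IsCentrallySymmetric {M : Type*} (G : Subgroup (Equiv.Perm M))
    (σ : M → (H →ₗ[ℂ] H)) : Prop :=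
  ∃ R : Representation ℂ G (H →ₗ[ℂ] H), IsCovariantRep G σ R ∧
    ∃ g : G, ∀ ρ : H →ₗ[ℂ] H, IsState ρ →
      R g ρ = (2 / (Module.finrank ℂ H : ℂ)) • LinearMap.id - ρ

/-- `bar` is a pairing of the alphabet by antipodal states of a qubit channel: an involution with
`σ (bar m) = 1 - σ m` and at most one fixed point (none, if `|M|` is even). If `σ` is injective
and centrally symmetric, then `bar` has to be the action of the group element `g` that implements
the central symmetry; if several letters have the same state, a pairing is a choice. -/
def IsAntipodalPairing {M : Type*} (σ : M → (H →ₗ[ℂ] H)) (bar : M → M) : Prop :=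
  Function.Involutive bar ∧ (∀ m, σ m + σ (bar m) = LinearMap.id) ∧
    ∀ m m', bar m = m → bar m' = m' → m = m'

end Operators

section Guesswork

variable {H : Type*} [NormedAddCommGroup H] [InnerProductSpace ℂ H]
variable {M : Type*} [Fintype M]

open scoped Classical in
/-- The guesswork for prior `p`, channel `σ`, numbering-valued measurement `π` and cost `γ`. -/
def guesswork (γ : Fin (Fintype.card M) → ℝ) (p : M → ℝ) (σ : M → (H →ₗ[ℂ] H))
    (π : Numbering M → (H →ₗ[ℂ] H)) : ℝ :=
  ∑ n : Numbering M, ∑ t, p (n t) * (tr (σ (n t) ∘ₗ π n)).re * γ t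

/-- The uniform prior. -/
def uniformPrior (M : Type*) [Fintype M] : M → ℝ := fun _ => (Fintype.card M : ℝ)⁻¹

open scoped Classical in
/-- `v` is the minimum guesswork: the minimum of the guesswork over all numbering-valued
measurements (in particular, it is attained). -/
def IsMinGuesswork (γ : Fin (Fintype.card M) → ℝ) (p : M → ℝ) (σ : M → (H →ₗ[ℂ] H))
    (v : ℝ) : Prop :=
  IsLeast {x : ℝ | ∃ π : Numbering M → (H →ₗ[ℂ] H), IsMeasurement π ∧ x = guesswork γ p σ π} v

/-- Balanced cost functions. -/
def IsBalanced {N : ℕ} (γ : Fin N → ℝ) : Prop := ∃ c : ℝ, ∀ t, γ t + γ t.rev = 2 * c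

/-- The average of a cost function. -/
def avg {N : ℕ} (γ : Fin N → ℝ) : ℝ := (∑ t, γ t) / N

/-- The cost function shifted to null average. -/
def centred {N : ℕ} (γ : Fin N → ℝ) : Fin N → ℝ := fun t => γ t - avg γ

/-- The operator `E` of a numbering. -/
def E (γ : Fin (Fintype.card M) → ℝ) (σ : M → (H →ₗ[ℂ] H)) (n : Numbering M) : H →ₗ[ℂ] H :=
  ((2 / (Fintype.card M : ℝ) : ℝ) : ℂ) • ∑ t, ((γ t : ℝ) : ℂ) • σ (n t)

/-- The objective function `‖E(n)‖`, to be maximized. -/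
def objective [FiniteDimensional ℂ H] (γ : Fin (Fintype.card M) → ℝ) (σ : M → (H →ₗ[ℂ] H))
    (n : Numbering M) : ℝ := traceNorm (E γ σ n)

end Guesswork

section BranchAndBound

variable {M : Type*} [Fintype M]

open scoped Classical in
/-- The feasible set. If `conj = some bar`, only numberings that query `bar m` at time
`|M| + 1 - t` whenever they query `m` at time `t` are kept; if `first = some m`, only numberings
whose first query is `m`. -/
def feasible (conj : Option (M → M)) (first : Option M) : Finset (Numbering M) :=
  Finset.univ.filter fun n =>
    (∀ bar ∈ conj, ∀ t, n t.rev = bar (n t)) ∧ (∀ m ∈ first, ∀ t, t.val = 0 → n t = m)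

open scoped Classical in
/-- The length of the longest common prefix of the numberings in `N`; this is the number
`t*_N - 1`, hence also the zero-based index of the branching time `t*_N`. -/
def commonPrefix (N : Finset (Numbering M)) : ℕ :=
  Nat.findGreatest (fun j => ∀ n ∈ N, ∀ n' ∈ N, ∀ t, t.val < j → n t = n' t) (Fintype.card M)

open scoped Classical in
/-- The letters `M*_N` that are still available at time `t*_N`: those not used at the times
`t < t*_N` nor, in the centrally symmetric mode, at the times `|M| + 1 - t` for `t < t*_N`. -/
def available (conj : Option (M → M)) (N : Finset (Numbering M)) : Finset M :=
  Finset.univ.filter fun m => ∀ n ∈ N, ∀ t, t.val < commonPrefix N →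
    n t ≠ m ∧ (conj.isSome = true → n t.rev ≠ m)

open scoped Classical in
/-- The branching rule: split `N` according to the letter queried at time `t*_N`
(an empty part is not a branch). -/
def brn (conj : Option (M → M)) (N : Finset (Numbering M)) : Finset (Finset (Numbering M)) :=
  ((available conj N).image fun m =>
    N.filter fun n => ∃ t, t.val = commonPrefix N ∧ n t = m).erase ∅

variable {H : Type*} [NormedAddCommGroup H] [InnerProductSpace ℂ H] [FiniteDimensional ℂ H]

open scoped Classical in
/-- The bounding rule, with `k = 1` in the centrally symmetric mode and `k = 0` otherwise.
The first sum is over the common prefix, hence the same for every `n ∈ N`. -/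
def bnd (γ : Fin (Fintype.card M) → ℝ) (σ : M → (H →ₗ[ℂ] H)) (conj : Option (M → M))
    (N : Finset (Numbering M)) : ℝ :=
  let k : ℕ := if conj.isSome = true then 1 else 0
  if hN : N.Nonempty then
    ((k : ℝ) + 1) *
      (traceNorm (∑ t with t.val < commonPrefix N, ((γ t : ℝ) : ℂ) • σ (hN.choose t)) +
        ∑ t with commonPrefix N ≤ t.val ∧ t.val < Fintype.card M / 2 ^ k, |γ t|)
  else 0

/-- A state of the search: the pool of subsets of the feasible set that are still to be explored,
and the best numbering found so far (if any). -/
structure SearchState (M : Type*) [Fintype M] where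
  /-- subsets still to be explored -/
  pool : Finset (Finset (Numbering M))
  /-- incumbent -/
  best : Option (Numbering M)

/-- `N` is a leaf: it consists of one numbering. -/
def IsLeaf (N : Finset (Numbering M)) : Prop := N.card = 1

/-- The bound of `N` shows that `N` has no numbering better than the incumbent. -/
def Prunable (γ : Fin (Fintype.card M) → ℝ) (σ : M → (H →ₗ[ℂ] H)) (conj : Option (M → M))
    (s : SearchState M) (N : Finset (Numbering M)) : Prop :=
  ∃ n, s.best = some n ∧ bnd γ σ conj N ≤ objective γ σ n

open scoped Classical in
/-- Branching: a subset in the pool that is neither a leaf nor pruned by its bound is replaced by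
its branches. -/
def BranchStep (γ : Fin (Fintype.card M) → ℝ) (σ : M → (H →ₗ[ℂ] H)) (conj : Option (M → M))
    (s s' : SearchState M) : Prop :=
  ∃ N ∈ s.pool, ¬ IsLeaf N ∧ ¬ Prunable γ σ conj s N ∧
    s' = ⟨s.pool.erase N ∪ brn conj N, s.best⟩

open scoped Classical in
/-- One round (time unit) on `C` computing units. Each unit takes one subset off the pool: it
evaluates the objective if this is a leaf, and discards the subset if it is pruned by its bound.
No unit may idle, except when these subsets exhaust the pool. The incumbent becomes a best
numbering among the old incumbent and the evaluated ones. -/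
def RoundStep (γ : Fin (Fintype.card M) → ℝ) (σ : M → (H →ₗ[ℂ] H)) (conj : Option (M → M))
    (C : ℕ) (s s' : SearchState M) : Prop :=
  ∃ L ⊆ s.pool, L.Nonempty ∧ (∀ N ∈ L, IsLeaf N ∨ Prunable γ σ conj s N) ∧
    (L.card = C ∨ (L.card < C ∧ L = s.pool)) ∧
    ∃ n ∈ s.best.toFinset ∪ (L.filter IsLeaf).biUnion id,
      (∀ n' ∈ s.best.toFinset ∪ (L.filter IsLeaf).biUnion id,
        objective γ σ n' ≤ objective γ σ n) ∧
      s' = ⟨s.pool \ L, some n⟩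

/-- `Run γ σ conj first C T B s`: some run of the algorithm on `C` computing units, started with
the feasible set as the only subset in the pool and no incumbent, reaches the state `s` after `T`
rounds and `B` branchings. The order in which subsets are selected is left open. -/
inductive Run (γ : Fin (Fintype.card M) → ℝ) (σ : M → (H →ₗ[ℂ] H)) (conj : Option (M → M))
    (first : Option M) (C : ℕ) : ℕ → ℕ → SearchState M → Prop
  | start : Run γ σ conj first C 0 0 ⟨{feasible conj first}, none⟩
  | branch {T B : ℕ} {s s' : SearchState M} :
      Run γ σ conj first C T B s → BranchStep γ σ conj s s' → Run γ σ conj first C T (B + 1) s'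
  | round {T B : ℕ} {s s' : SearchState M} :
      Run γ σ conj first C T B s → RoundStep γ σ conj C s s' → Run γ σ conj first C (T + 1) B s'

/-- The branch-and-bound algorithm (run on `γ` shifted to null average) computes exactly the
minimum guesswork of `σ` for the uniform prior, in time at most `⌈W / C⌉` on `C` computing units.
That is, whatever the selection order: at most `⌈W / C⌉` rounds and fewer than `W` branchings are
made; the run never gets stuck before the pool is empty; and once the pool is empty, the incumbent
`n` yields the minimum guesswork as the closed-form expression `avg γ - ‖E(n)‖ / 2`. -/
def ComputesMinGuesswork (γ : Fin (Fintype.card M) → ℝ) (σ : M → (H →ₗ[ℂ] H))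
    (conj : Option (M → M)) (first : Option M) (C W : ℕ) : Prop :=
  ∀ (T B : ℕ) (s : SearchState M), Run (centred γ) σ conj first C T B s →
    T ≤ ⌈(W : ℚ) / (C : ℚ)⌉₊ ∧ B < W ∧
    (s.pool ≠ ∅ → ∃ s', BranchStep (centred γ) σ conj s s' ∨ RoundStep (centred γ) σ conj C s s') ∧
    (s.pool = ∅ → ∃ n, s.best = some n ∧
      IsMinGuesswork γ (uniformPrior M) σ (avg γ - objective (centred γ) σ n / 2))

end BranchAndBound

end

end Guesswork

/-! Optimality. Each `E (centred γ) σ n` is a traceless Hermitian operator on a qubit, with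
eigenvalues ±‖E(n)‖/2. The guesswork of a measurement π is `avg γ` plus half of ∑ Tr[E(n)π(n)].
Since E(n) ≥ -(‖E(n)‖/2)·1 and the π(n) have total trace 2, it is at least `avg γ` minus half of max
‖E(n)‖. Balance gives the reversed numbering the operator -E(n), so measuring the eigenprojections
of a maximizer, and announcing it or its reversal, attains this value
(`isMinGuesswork_of_forall_objective_le`).

Restriction. ‖E(n)‖ is the maximum of Tr[(P-Q)E(n)] over effect pairs. Keep the optimal pair of n
and sort the letters by a(m) = Tr[(P-Q)σ(m)]: by rearrangement, the sorted numbering has at least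
the same objective. Since Tr(P-Q) = 0, a is odd under an antipodal pairing, and the sorting can be
made compatible with it. Under transitivity a group element moves the maximum of a to the chosen
letter, which can then be queried first.

Search. Branches partition a subset. The bound estimates the common prefix by its trace norm and
every later letter by |a| ≤ 1 (`objective_le_bnd`). Disposed subsets are nonempty and disjoint, so
there are at most as many of them as feasible numberings, whose number is bounded letter by letter
by a factorial, or by a double factorial if each letter also fixes its antipode. Every branching
adds at least one subset, so branchings are bounded as well (`SearchInvariant`). -/

namespace Guesswork

/-! ### Trace norm and two-outcome measurements. -/

section Operators

variable {H : Type*} [NormedAddCommGroup H] [InnerProductSpace ℂ H] [FiniteDimensional ℂ H]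

open scoped InnerProductSpace

theorem roots_prod_X_sub_C {ι : Type*} [Fintype ι] (c : ι → ℂ) :
    (∏ i, (Polynomial.X - Polynomial.C (c i))).roots = Finset.univ.val.map c := by
  rw [Polynomial.roots_prod _ _ (by simp [Finset.prod_ne_zero_iff, Polynomial.X_sub_C_ne_zero])]
  simp

/-- The trace norm of a symmetric operator is the sum of the absolute eigenvalues. -/
theorem traceNorm_eq_sum_abs_eigenvalues {n : ℕ} (hn : Module.finrank ℂ H = n)
    {A : H →ₗ[ℂ] H} (hA : A.IsSymmetric) :
    traceNorm A = ∑ i, |hA.eigenvalues hn i| := by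
  have hsq : LinearMap.adjoint A ∘ₗ A = A * A := by
    rw [hA.adjoint_eq]; rfl
  have hB := A.isSymmetric_adjoint_comp_self
  have h1 := hB.roots_charpoly_eq_eigenvalues hn
  have h2 : (LinearMap.adjoint A ∘ₗ A).charpoly.roots =
      Finset.univ.val.map fun i => (((hA.eigenvalues hn i) ^ 2 : ℝ) : ℂ) := by
    rw [hsq, ← LinearMap.charpoly_toMatrix _ (hA.eigenvectorBasis hn).toBasis,
      LinearMap.toMatrix_mul, hA.toMatrix_eigenvectorBasis, Matrix.diagonal_mul_diagonal,
      Matrix.charpoly_diagonal, roots_prod_X_sub_C]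
    refine Multiset.map_congr rfl fun i _ => ?_
    simp [sq]
  -- The two spectra are compared as multisets: sorting the eigenvalues of A does not sort their
  -- squares.
  have h3 : (Finset.univ.val.map fun i => √(hB.eigenvalues hn i)) =
      Finset.univ.val.map fun i => |hA.eigenvalues hn i| := by
    have := congrArg (Multiset.map fun z : ℂ => √z.re) (h1.symm.trans h2)
    simpa [Multiset.map_map, Function.comp_def, Real.sqrt_sq_eq_abs, ← Complex.ofReal_pow] using this
  have h4 : ∑ i, √(hB.eigenvalues hn i) = ∑ i, |hA.eigenvalues hn i| :=
    congrArg Multiset.sum h3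
  rw [← h4, traceNorm, hn, Finset.sum_range]
  exact Finset.sum_congr rfl fun i _ => A.singularValues_fin hn i

theorem traceNorm_nonneg (A : H →ₗ[ℂ] H) : 0 ≤ traceNorm A :=
  Finset.sum_nonneg fun i _ => A.singularValues_nonneg i

/-- A pair of effects: a measurement with two outcomes. -/
structure IsEffectPair (P Q : H →ₗ[ℂ] H) : Prop where
  left : P.IsPositive
  right : Q.IsPositive
  add : P + Q = LinearMap.id

omit [FiniteDimensional ℂ H] in
theorem tr_comp_comm (A B : H →ₗ[ℂ] H) : tr (A ∘ₗ B) = tr (B ∘ₗ A) :=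
  LinearMap.trace_mul_comm ℂ A B

theorem tr_comp_eq_sum {n : ℕ} (hn : Module.finrank ℂ H = n) {A : H →ₗ[ℂ] H}
    (hA : A.IsSymmetric) (B : H →ₗ[ℂ] H) :
    tr (B ∘ₗ A) = ∑ i, (hA.eigenvalues hn i : ℂ) *
      ⟪hA.eigenvectorBasis hn i, B (hA.eigenvectorBasis hn i)⟫_ℂ := by
  rw [tr, LinearMap.trace_eq_sum_inner _ (hA.eigenvectorBasis hn)]
  simp [-Complex.coe_smul, inner_smul_right]

theorem tr_comp_nonneg {A B : H →ₗ[ℂ] H} (hA : A.IsPositive) (hB : B.IsPositive) :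
    0 ≤ (tr (B ∘ₗ A)).re := by
  rw [tr_comp_eq_sum rfl hA.isSymmetric, Complex.re_sum]
  refine Finset.sum_nonneg fun i _ => ?_
  rw [Complex.re_ofReal_mul]
  exact mul_nonneg (hA.nonneg_eigenvalues rfl i) (hB.re_inner_nonneg_right _)

/-- In an eigenbasis of A the diagonal entries of P - Q lie in [-1, 1], because P and Q are positive
with sum 1. This is the easy half of the duality between trace norm and effect pairs. -/
theorem re_tr_sub_comp_le_traceNorm {P Q : H →ₗ[ℂ] H} (h : IsEffectPair P Q)
    {A : H →ₗ[ℂ] H} (hA : A.IsSymmetric) : (tr ((P - Q) ∘ₗ A)).re ≤ traceNorm A := by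
  rw [tr_comp_eq_sum rfl hA, Complex.re_sum, traceNorm_eq_sum_abs_eigenvalues rfl hA]
  refine Finset.sum_le_sum fun i _ => ?_
  set b := hA.eigenvectorBasis rfl i with hb
  have hP : 0 ≤ (⟪b, P b⟫_ℂ).re := h.left.re_inner_nonneg_right _
  have hQ : 0 ≤ (⟪b, Q b⟫_ℂ).re := h.right.re_inner_nonneg_right _
  have hPQ : (⟪b, P b⟫_ℂ).re + (⟪b, Q b⟫_ℂ).re = 1 := by
    rw [← Complex.add_re, ← inner_add_right, ← LinearMap.add_apply, h.add]
    simp [hb]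
  rw [Complex.re_ofReal_mul, LinearMap.sub_apply, inner_sub_right, Complex.sub_re]
  refine (le_abs_self _).trans ?_
  rw [abs_mul]
  exact mul_le_of_le_one_right (abs_nonneg _) (abs_le.2 ⟨by linarith, by linarith⟩)

omit [FiniteDimensional ℂ H] in
theorem IsEffectPair.symm {P Q : H →ₗ[ℂ] H} (h : IsEffectPair P Q) : IsEffectPair Q P :=
  ⟨h.right, h.left, by rw [add_comm, h.add]⟩

/-- An effect pair takes values of modulus at most one on states. -/
theorem abs_re_tr_sub_comp_le_one {P Q : H →ₗ[ℂ] H} (h : IsEffectPair P Q)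
    {ρ : H →ₗ[ℂ] H} (hρ : IsState ρ) : |(tr ((P - Q) ∘ₗ ρ)).re| ≤ 1 := by
  have hP := tr_comp_nonneg hρ.1 h.left
  have hQ := tr_comp_nonneg hρ.1 h.right
  have hPQ : (tr (P ∘ₗ ρ)).re + (tr (Q ∘ₗ ρ)).re = 1 := by
    have : tr (P ∘ₗ ρ) + tr (Q ∘ₗ ρ) = 1 := by
      rw [← hρ.2, tr, tr, ← map_add, ← LinearMap.add_comp, h.add, LinearMap.id_comp, tr]
    rw [← Complex.add_re, this, Complex.one_re]
  have : (tr ((P - Q) ∘ₗ ρ)).re = (tr (P ∘ₗ ρ)).re - (tr (Q ∘ₗ ρ)).re := by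
    rw [← Complex.sub_re, LinearMap.sub_comp, tr, tr, tr, map_sub]
  rw [this]
  exact abs_le.2 ⟨by linarith, by linarith⟩

/-- A traceless symmetric operator on a qubit is half its trace norm times the difference of the
projections on two orthogonal lines, which are eigenspaces. -/
theorem exists_effectPair_of_traceless (hH : Module.finrank ℂ H = 2) {A : H →ₗ[ℂ] H}
    (hA : A.IsSymmetric) (htr : tr A = 0) :
    ∃ P Q : H →ₗ[ℂ] H, IsEffectPair P Q ∧ tr P = 1 ∧ tr Q = 1 ∧
      A ∘ₗ P = ((traceNorm A / 2 : ℝ) : ℂ) • P ∧ A ∘ₗ Q = -((traceNorm A / 2 : ℝ) : ℂ) • Q := by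
  set b := hA.eigenvectorBasis hH
  set μ := hA.eigenvalues hH with hμ
  have hsum : μ 0 + μ 1 = 0 := by
    have := hA.trace_eq_sum_eigenvalues hH
    rw [← tr, htr, Fin.sum_univ_two] at this
    simpa [← Complex.ofReal_add] using congrArg Complex.re this.symm
  have hle : μ 1 ≤ μ 0 := hA.eigenvalues_antitone hH (by decide)
  -- The eigenvalues come in decreasing order with sum zero, so `μ 0` is the nonnegative one and `μ
  -- 1` is its negative.
  have hN : traceNorm A / 2 = μ 0 := by
    rw [traceNorm_eq_sum_abs_eigenvalues hH hA, Fin.sum_univ_two, ← hμ,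
      abs_of_nonneg (by linarith), abs_of_nonpos (by linarith)]
    linarith
  have hcomp : ∀ i, A ∘ₗ (InnerProductSpace.rankOne ℂ (b i) (b i)).toLinearMap =
      ((μ i : ℝ) : ℂ) • (InnerProductSpace.rankOne ℂ (b i) (b i)).toLinearMap := by
    intro i
    ext x
    simp only [LinearMap.comp_apply, LinearMap.smul_apply, ContinuousLinearMap.coe_coe,
      InnerProductSpace.rankOne_apply, map_smul, b, μ, hA.apply_eigenvectorBasis]
    exact smul_comm _ _ _
  refine ⟨(InnerProductSpace.rankOne ℂ (b 0) (b 0)).toLinearMap,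
    (InnerProductSpace.rankOne ℂ (b 1) (b 1)).toLinearMap, ⟨?_, ?_, ?_⟩, ?_, ?_, ?_, ?_⟩
  · exact (InnerProductSpace.isPositive_rankOne_self _).toLinearMap
  · exact (InnerProductSpace.isPositive_rankOne_self _).toLinearMap
  · ext x
    have := b.sum_repr' x
    rw [Fin.sum_univ_two] at this
    simpa using this
  · simp [tr, InnerProductSpace.trace_rankOne]
  · simp [tr, InnerProductSpace.trace_rankOne]
  · rw [hcomp, hN]
  · rw [hcomp, hN, eq_neg_of_add_eq_zero_right hsum, Complex.ofReal_neg]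

end Operators

/-! ### The closed form of the minimum guesswork. -/

section Optimality

variable {H : Type*} [NormedAddCommGroup H] [InnerProductSpace ℂ H]

/-- The expectation of the observable `P - Q`, as a real-linear functional of the operator. -/
noncomputable def effectValue (P Q : H →ₗ[ℂ] H) : (H →ₗ[ℂ] H) →ₗ[ℝ] ℝ where
  toFun A := (tr ((P - Q) ∘ₗ A)).re
  map_add' A B := by simp [tr, LinearMap.comp_add]
  map_smul' c A := by
    rw [← Complex.coe_smul, LinearMap.comp_smul, tr, map_smul]
    simp [tr]

theorem effectValue_apply (P Q A : H →ₗ[ℂ] H) :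
    effectValue P Q A = (tr ((P - Q) ∘ₗ A)).re := rfl

theorem sum_comp {ι : Type*} (s : Finset ι) (A : ι → (H →ₗ[ℂ] H)) (B : H →ₗ[ℂ] H) :
    (∑ i ∈ s, A i) ∘ₗ B = ∑ i ∈ s, A i ∘ₗ B :=
  Finset.sum_mul s A B

theorem comp_sum {ι : Type*} (s : Finset ι) (A : ι → (H →ₗ[ℂ] H)) (B : H →ₗ[ℂ] H) :
    B ∘ₗ (∑ i ∈ s, A i) = ∑ i ∈ s, B ∘ₗ A i :=
  Finset.mul_sum s A B

/-- Statistical morphisms pull effect pairs back to effect pairs. -/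
theorem IsStatisticalMorphism.exists_effectPair {M : Type*} {σ : M → (H →ₗ[ℂ] H)}
    {R : (H →ₗ[ℂ] H) →ₗ[ℂ] (H →ₗ[ℂ] H)} (hR : IsStatisticalMorphism σ R) {P Q : H →ₗ[ℂ] H}
    (h : IsEffectPair P Q) :
    ∃ P' Q', IsEffectPair P' Q' ∧
      ∀ m, effectValue P' Q' (σ m) = effectValue P Q (R (σ m)) := by
  obtain ⟨τ, hτ, hτσ⟩ := hR.2 2 ![P, Q] 
    ⟨by simp [Fin.forall_fin_two, h.left, h.right], by simp [h.add]⟩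
  refine ⟨τ 0, τ 1, ⟨hτ.1 0, hτ.1 1, by rw [← hτ.2, Fin.sum_univ_two]⟩, fun m => ?_⟩
  have h0 := hτσ m 0
  have h1 := hτσ m 1
  simp only [Matrix.cons_val_zero, Matrix.cons_val_one] at h0 h1
  rw [effectValue_apply, effectValue_apply, LinearMap.sub_comp, LinearMap.sub_comp, tr, tr, map_sub,
    map_sub, ← tr, ← tr, ← tr, ← tr, h0, h1]

variable {M : Type*} [Fintype M]

theorem effectValue_E (P Q : H →ₗ[ℂ] H) (γ : Fin (Fintype.card M) → ℝ) (σ : M → (H →ₗ[ℂ] H))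
    (n : Numbering M) : effectValue P Q (E γ σ n) =
      2 / (Fintype.card M : ℝ) * ∑ t, γ t * effectValue P Q (σ (n t)) := by
  simp only [E, Complex.coe_smul, map_smul, map_sum, smul_eq_mul]

theorem tr_E {γ : Fin (Fintype.card M) → ℝ} (hγ : ∑ t, γ t = 0) {σ : M → (H →ₗ[ℂ] H)}
    (hσ : IsCQChannel σ) (n : Numbering M) : tr (E γ σ n) = 0 := by
  have h : ∀ m, LinearMap.trace ℂ H (σ m) = 1 := fun m => (hσ m).2
  rw [tr, E, map_smul, map_sum]
  simp only [map_smul, h, smul_eq_mul, mul_one]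
  rw [← Complex.ofReal_sum, hγ]
  simp

theorem isSymmetric_sum_smul {ι : Type*} (s : Finset ι) (c : ι → ℝ) {A : ι → (H →ₗ[ℂ] H)}
    (hA : ∀ i ∈ s, (A i).IsSymmetric) : (∑ i ∈ s, ((c i : ℝ) : ℂ) • A i).IsSymmetric := by
  classical
  induction s using Finset.induction_on with
  | empty => simp
  | insert i s hi ih =>
    rw [Finset.sum_insert hi]
    exact ((hA i (Finset.mem_insert_self i s)).smul (Complex.conj_ofReal _)).add
      (ih fun j hj => hA j (Finset.mem_insert_of_mem hj))

theorem isSymmetric_E (γ : Fin (Fintype.card M) → ℝ) {σ : M → (H →ₗ[ℂ] H)}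
    (hσ : IsCQChannel σ) (n : Numbering M) : (E γ σ n).IsSymmetric :=
  (isSymmetric_sum_smul _ _ fun t _ => (hσ (n t)).1.isSymmetric).smul (Complex.conj_ofReal _)

theorem sum_centred [Nonempty M] (γ : Fin (Fintype.card M) → ℝ) : ∑ t, centred γ t = 0 := by
  have h : (Fintype.card M : ℝ) ≠ 0 := by exact_mod_cast Fintype.card_ne_zero
  simp only [centred, avg, Finset.sum_sub_distrib, Finset.sum_const, Finset.card_univ,
    Fintype.card_fin, nsmul_eq_mul]
  field_simp
  ring

theorem centred_add_rev [Nonempty M] {γ : Fin (Fintype.card M) → ℝ} (hbal : IsBalanced γ) (t) :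
    centred γ t + centred γ t.rev = 0 := by
  obtain ⟨c, hc⟩ := hbal
  have h : ∀ s, centred γ s + centred γ s.rev = 2 * c - 2 * avg γ := fun s => by
    rw [← hc s, centred, centred]; ring
  have h2 : ∑ s, (centred γ s + centred γ s.rev) = 0 := by
    rw [Finset.sum_add_distrib, sum_centred, zero_add]
    exact (Equiv.sum_comp Fin.revPerm (centred γ)).trans (sum_centred γ)
  simp only [h, Finset.sum_const, Finset.card_univ, Fintype.card_fin, nsmul_eq_mul,
    mul_eq_zero] at h2
  rw [h]
  exact h2.resolve_left (by exact_mod_cast Fintype.card_ne_zero)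

theorem antitone_centred {N : ℕ} {γ : Fin N → ℝ} (h : Antitone γ) : Antitone (centred γ) :=
  fun _ _ hst => sub_le_sub_right (h hst) _

open scoped Classical in
-- Split γ into its average and its centred part. A numbering meets each letter once and π sums to
-- 1, so the probabilities add up to |M| and the average contributes exactly `avg γ`. The final half
-- offsets the factor 2 in `E`.
theorem guesswork_uniformPrior [Nonempty M] (γ : Fin (Fintype.card M) → ℝ)
    {σ : M → (H →ₗ[ℂ] H)} (hσ : IsCQChannel σ) {π : Numbering M → (H →ₗ[ℂ] H)}
    (hπ : IsMeasurement π) :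
    guesswork γ (uniformPrior M) σ π =
      avg γ + (∑ n, (tr (E (centred γ) σ n ∘ₗ π n)).re) / 2 := by
  have hN : (Fintype.card M : ℝ) ≠ 0 := by exact_mod_cast Fintype.card_ne_zero
  have h1 : ∀ n, (tr (E (centred γ) σ n ∘ₗ π n)).re =
      2 / (Fintype.card M : ℝ) * ∑ t, centred γ t * (tr (σ (n t) ∘ₗ π n)).re := by
    intro n
    rw [E, LinearMap.smul_comp, sum_comp, tr, map_smul, map_sum, smul_eq_mul,
      Complex.re_ofReal_mul, Complex.re_sum]
    congr 1
    refine Finset.sum_congr rfl fun t _ => ?_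
    rw [LinearMap.smul_comp, map_smul, smul_eq_mul, Complex.re_ofReal_mul, tr]
  have h2 : ∑ n : Numbering M, ∑ t, (tr (σ (n t) ∘ₗ π n)).re = Fintype.card M := by
    have : ∀ n : Numbering M, ∑ t, (tr (σ (n t) ∘ₗ π n)).re = ∑ m, (tr (σ m ∘ₗ π n)).re :=
      fun n => Equiv.sum_comp n fun m => (tr (σ m ∘ₗ π n)).re
    rw [Finset.sum_congr rfl fun n _ => this n, Finset.sum_comm]
    have h : ∀ m, ∑ n : Numbering M, (tr (σ m ∘ₗ π n)).re = 1 := by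
      intro m
      have h3 : ∑ n : Numbering M, σ m ∘ₗ π n = σ m := by
        rw [← comp_sum, hπ.2, LinearMap.comp_id]
      rw [← Complex.re_sum]
      simp only [tr]
      rw [← map_sum, h3]
      exact congrArg Complex.re (hσ m).2
    simp [h]
  have h3 : ∀ n t, uniformPrior M (n t) * (tr (σ (n t) ∘ₗ π n)).re * γ t =
      (Fintype.card M : ℝ)⁻¹ * (centred γ t * (tr (σ (n t) ∘ₗ π n)).re) +
        (Fintype.card M : ℝ)⁻¹ * avg γ * (tr (σ (n t) ∘ₗ π n)).re := by
    intro n t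
    rw [uniformPrior, centred]
    ring
  simp only [guesswork, h3, h1, Finset.sum_add_distrib, ← Finset.mul_sum, h2]
  field_simp
  ring

variable [FiniteDimensional ℂ H]

theorem score_le_objective {P Q : H →ₗ[ℂ] H} (h : IsEffectPair P Q)
    (γ : Fin (Fintype.card M) → ℝ) {σ : M → (H →ₗ[ℂ] H)} (hσ : IsCQChannel σ) (n : Numbering M) :
    2 / (Fintype.card M : ℝ) * ∑ t, γ t * effectValue P Q (σ (n t)) ≤ objective γ σ n := by
  rw [← effectValue_E]
  exact re_tr_sub_comp_le_traceNorm h (isSymmetric_E γ hσ n)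

/-- The pair consists of the two eigenprojections of E(n). Both have trace one, so the observable
vanishes at the identity; this later makes it odd under antipodes. -/
theorem exists_score_eq_objective (hH : Module.finrank ℂ H = 2)
    {γ : Fin (Fintype.card M) → ℝ} (hγ : ∑ t, γ t = 0)
    {σ : M → (H →ₗ[ℂ] H)} (hσ : IsCQChannel σ) (n : Numbering M) :
    ∃ P Q : H →ₗ[ℂ] H, IsEffectPair P Q ∧ effectValue P Q LinearMap.id = 0 ∧
      2 / (Fintype.card M : ℝ) * ∑ t, γ t * effectValue P Q (σ (n t)) = objective γ σ n := by
  obtain ⟨P, Q, h, hP, hQ, hAP, hAQ⟩ :=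
    exists_effectPair_of_traceless hH (isSymmetric_E γ hσ n) (tr_E hγ hσ n)
  refine ⟨P, Q, h, ?_, ?_⟩
  · rw [effectValue_apply, LinearMap.comp_id, tr, map_sub, ← tr, ← tr, hP, hQ]
    simp
  · rw [← effectValue_E, effectValue_apply, tr_comp_comm, LinearMap.comp_sub, hAP, hAQ, tr, map_sub,
      map_smul, map_smul, ← tr, ← tr, hP, hQ, objective]
    simp

/-- Since A = (‖A‖/2)(P - Q) and P + Q = 1, A is at least -(‖A‖/2)·1. -/
theorem neg_traceNorm_mul_le (hH : Module.finrank ℂ H = 2) {A π : H →ₗ[ℂ] H}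
    (hA : A.IsSymmetric) (htr : tr A = 0) (hπ : π.IsPositive) :
    -(traceNorm A / 2) * (tr π).re ≤ (tr (A ∘ₗ π)).re := by
  obtain ⟨P, Q, h, -, -, hAP, hAQ⟩ := exists_effectPair_of_traceless hH hA htr
  have hA' : A = (traceNorm A / 2) • (P - Q) := by
    conv_lhs => rw [← LinearMap.comp_id A, ← h.add, LinearMap.comp_add, hAP, hAQ]
    rw [← Complex.coe_smul]
    module
  have hπ' : (tr π).re = (tr (P ∘ₗ π)).re + (tr (Q ∘ₗ π)).re := by
    rw [← Complex.add_re, tr, tr, tr, ← map_add, ← LinearMap.add_comp, h.add, LinearMap.id_comp]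
  have hAπ : (tr (A ∘ₗ π)).re = traceNorm A / 2 * ((tr (P ∘ₗ π)).re - (tr (Q ∘ₗ π)).re) := by
    conv_lhs => rw [hA', ← Complex.coe_smul, LinearMap.smul_comp, tr, map_smul, LinearMap.sub_comp,
      map_sub, smul_eq_mul, Complex.re_ofReal_mul, Complex.sub_re]
    rfl
  have h1 := tr_comp_nonneg hπ h.left
  have h3 := mul_nonneg (traceNorm_nonneg A) h1
  rw [hπ', hAπ]
  nlinarith

open scoped Classical in
/-- A numbering that maximizes `‖E(n)‖` determines the minimum guesswork of a qubit channel. -/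
theorem isMinGuesswork_of_forall_objective_le [Nonempty M] (hH : Module.finrank ℂ H = 2)
    {γ : Fin (Fintype.card M) → ℝ} (hbal : IsBalanced γ) {σ : M → (H →ₗ[ℂ] H)}
    (hσ : IsCQChannel σ) {n : Numbering M}
    (hn : ∀ n', objective (centred γ) σ n' ≤ objective (centred γ) σ n) :
    IsMinGuesswork γ (uniformPrior M) σ (avg γ - objective (centred γ) σ n / 2) := by
  have hsymm := isSymmetric_E (centred γ) hσ
  have htr := tr_E (sum_centred γ) hσ
  constructor
  · obtain ⟨P, Q, h, hP, hQ, hAP, hAQ⟩ := exists_effectPair_of_traceless hH (hsymm n) (htr n)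
    -- By balance, reversing time negates E. Outcome Q, the negative eigenspace of E(n), announces
    -- n; outcome P announces the reversal.
    let r : Numbering M := Fin.revPerm.trans n
    have hr : E (centred γ) σ r = -E (centred γ) σ n := by
      rw [E, E, ← smul_neg, ← Finset.sum_neg_distrib,
        ← Equiv.sum_comp Fin.revPerm fun t => ((centred γ t : ℝ) : ℂ) • σ (r t)]
      congr 1
      refine Finset.sum_congr rfl fun t _ => ?_
      have := centred_add_rev hbal t
      rw [← neg_smul, ← Complex.ofReal_neg, ← eq_neg_of_add_eq_zero_right this]
      simp [r]
    -- A sum of two indicators rather than a case distinction: it also covers n = r, which happens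
    -- when |M| = 1.
    let π : Numbering M → (H →ₗ[ℂ] H) := fun x => (if x = n then Q else 0) + if x = r then P else 0
    have hπ : IsMeasurement π := by
      constructor
      · intro x
        refine LinearMap.IsPositive.add ?_ ?_ <;> split_ifs
        exacts [h.right, LinearMap.isPositive_zero, h.left, LinearMap.isPositive_zero]
      · simp [π, Finset.sum_add_distrib, h.symm.add]
    refine ⟨π, hπ, ?_⟩
    have h1 : ∀ x, (tr (E (centred γ) σ x ∘ₗ π x)).re =
        (if x = n then (tr (E (centred γ) σ n ∘ₗ Q)).re else 0) +
          if x = r then (tr (E (centred γ) σ r ∘ₗ P)).re else 0 := by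
      intro x
      rw [LinearMap.comp_add, tr, map_add, Complex.add_re]
      congr 1
      · split_ifs with hx
        · rw [hx, tr]
        · simp
      · split_ifs with hx
        · rw [hx, tr]
        · simp
    rw [guesswork_uniformPrior γ hσ hπ, Finset.sum_congr rfl fun x _ => h1 x,
      Finset.sum_add_distrib, Finset.sum_ite_eq', Finset.sum_ite_eq', hr, LinearMap.neg_comp, hAP,
      hAQ, tr, tr, map_neg, map_smul, map_smul, ← tr, ← tr, hP, hQ, objective]
    simp
    ring
  · rintro _ ⟨π, hπ, rfl⟩
    rw [guesswork_uniformPrior γ hσ hπ]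
    have h1 : ∀ x, -(objective (centred γ) σ n / 2) * (tr (π x)).re ≤
        (tr (E (centred γ) σ x ∘ₗ π x)).re := by
      intro x
      refine le_trans ?_ (neg_traceNorm_mul_le hH (hsymm x) (htr x) (hπ.1 x))
      refine mul_le_mul_of_nonneg_right ?_ ?_
      · have := hn x
        rw [objective] at this
        linarith
      · have := tr_comp_nonneg (hπ.1 x) LinearMap.isPositive_id
        rwa [LinearMap.id_comp] at this
    have h2 : ∑ x, (tr (π x)).re = 2 := by
      rw [← Complex.re_sum]
      simp only [tr]
      rw [← map_sum, hπ.2, LinearMap.trace_id, hH]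
      simp
    have h3 := Finset.sum_le_sum fun x (_ : x ∈ Finset.univ) => h1 x
    rw [← Finset.mul_sum, h2] at h3
    linarith

end Optimality

/-! ### Sorting the alphabet by a real function, with controlled tie-breaking. -/

section Sorting

variable {M : Type*} [Fintype M]

theorem exists_strictAnti_numbering {α : Type*} [LinearOrder α] {κ : M → α}
    (hκ : Function.Injective κ) : ∃ n : Numbering M, StrictAnti fun t => κ (n t) := by
  let _ : LinearOrder M := LinearOrder.lift' (OrderDual.toDual ∘ κ) (OrderDual.toDual.injective.comp hκ)
  exact ⟨(Fintype.orderIsoFinOfCardEq M rfl).toEquiv,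
    fun s t hst => (Fintype.orderIsoFinOfCardEq M rfl).strictMono hst⟩

/-- Uniqueness of the sorted numbering lets it inherit the symmetries of its key. -/
theorem numbering_eq_of_strictAnti {α : Type*} [LinearOrder α] {κ : M → α}
    (hκ : Function.Injective κ) {n n' : Numbering M} (h : StrictAnti fun t => κ (n t))
    (h' : StrictAnti fun t => κ (n' t)) : n = n' := by
  have hr : ∀ p : Numbering M, Set.range (fun t => κ (p t)) = Set.range κ :=
    fun p => p.surjective.range_comp κ
  ext t
  exact hκ (congrFun ((h.range_inj h').1 ((hr n).trans (hr n').symm)) t)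

theorem apply_zero_of_strictAnti {α : Type*} [LinearOrder α] {κ : M → α} {n : Numbering M}
    (h : StrictAnti fun t => κ (n t)) {m : M} (hm : ∀ x, x ≠ m → κ x < κ m)
    {t : Fin (Fintype.card M)} (ht : t.val = 0) : n t = m := by
  by_contra hne
  obtain ⟨s, rfl⟩ := n.surjective m
  have hts : t < s := by
    refine lt_of_le_of_ne (Fin.le_def.2 (by omega)) fun h => hne (by rw [h])
  exact lt_asymm (hm _ hne) (h hts)

/-- Ranks for breaking ties; the prescribed first letter gets the top rank, so it precedes every
letter with the same value. -/
theorem exists_injective_nat_le (first : Option M) :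
    ∃ i : M → ℕ, Function.Injective i ∧ ∀ m ∈ first, ∀ x, i x ≤ i m := by
  classical
  have e := Fintype.equivFin M
  cases first with
  | none => exact ⟨fun m => e m, fun x y h => e.injective (Fin.ext h), by simp⟩
  | some m =>
    refine ⟨fun x => if x = m then Fintype.card M else e x, fun x y h => ?_, ?_⟩
    · have hx := (e x).isLt
      have hy := (e y).isLt
      by_cases h1 : x = m <;> by_cases h2 : y = m
      · rw [h1, h2]
      · simp only [h1, h2, if_true, if_false] at h; omega
      · simp only [h1, h2, if_true, if_false] at h; omega
      · simp only [h1, h2, if_false] at h; exact e.injective (Fin.ext h)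
    · intro m' hm' x
      obtain rfl : m = m' := by simpa using hm'
      have hx := (e x).isLt
      dsimp only
      rw [if_pos (rfl : m = m)]
      split_ifs <;> omega

/-- Any real function on the alphabet is sorted by some numbering, which starts with a given
maximum point. -/
theorem exists_antitone_mem_feasible (a : M → ℝ) {first : Option M}
    (hfirst : ∀ m ∈ first, ∀ x, a x ≤ a m) :
    ∃ n ∈ feasible none first, Antitone fun t => a (n t) := by
  obtain ⟨i, hi, hmax⟩ := exists_injective_nat_le first
  let κ : M → ℝ ×ₗ ℕ := fun m => toLex (a m, i m)
  have hκ : Function.Injective κ := fun x y h => hi (congrArg (fun z => (ofLex z).2) h)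
  obtain ⟨n, hn⟩ := exists_strictAnti_numbering hκ
  refine ⟨n, ?_, fun s t hst => ?_⟩
  · simp only [feasible, Finset.mem_filter, Finset.mem_univ, true_and]
    refine ⟨by simp, fun m hm t ht => apply_zero_of_strictAnti hn (fun x hx => ?_) ht⟩
    rw [Prod.Lex.toLex_lt_toLex]
    rcases (hfirst m hm x).lt_or_eq with h | h
    · exact Or.inl h
    · exact Or.inr ⟨h, lt_of_le_of_ne (hmax m hm x) fun h' => hx (hi h')⟩
  · exact Prod.Lex.monotone_fst _ _ (hn.antitone hst)

/-- A real function that is odd for an involution with at most one fixed point is sorted by some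
numbering that is compatible with the involution and starts with a given maximum point. -/
theorem exists_antitone_mem_feasible_of_involutive {bar : M → M} (hbar : Function.Involutive bar)
    (hfix : ∀ m m', bar m = m → bar m' = m' → m = m') {a : M → ℝ} (ha : ∀ m, a (bar m) = -a m)
    {first : Option M} (hfirst : ∀ m ∈ first, bar m ≠ m ∧ ∀ x, a x ≤ a m) :
    ∃ n ∈ feasible (some bar) first, Antitone fun t => a (n t) := by
  obtain ⟨i, hi, hmax⟩ := exists_injective_nat_le first
  -- An odd injective tie-breaker: the absolute value, one plus the larger rank in {m, bar m},
  -- identifies the pair, and the sign tells its members apart. The added one reserves 0 for the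
  -- fixed point.
  let b : M → ℤ := fun m => if i (bar m) < i m then i m + 1 else
    if i m < i (bar m) then -(i (bar m) + 1) else 0
  have hb : ∀ m, b (bar m) = -b m := by
    intro m
    simp only [b, hbar m]
    split_ifs <;> omega
  have hbinj : Function.Injective b := by
    intro x y h
    have hbi : i (bar x) = i (bar y) → x = y := fun h => hbar.injective (hi h)
    have hfx : i (bar x) = i x → i (bar y) = i y → x = y := fun h h' => hfix _ _ (hi h) (hi h')
    simp only [b] at h
    by_contra hne
    have h1 : i x ≠ i y := fun h => hne (hi h)
    have h2 : i (bar x) ≠ i (bar y) := fun h => hne (hbi h)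
    have h3 : ¬ (i (bar x) = i x ∧ i (bar y) = i y) := fun h => hne (hfx h.1 h.2)
    split_ifs at h <;> omega
  let κ : M → ℝ ×ₗ ℤ := fun m => toLex (a m, b m)
  have hκ : Function.Injective κ := fun x y h => hbinj (congrArg (fun z => (ofLex z).2) h)
  have hκbar : ∀ x y, κ x < κ y → κ (bar y) < κ (bar x) := by
    intro x y h
    simp only [κ, Prod.Lex.toLex_lt_toLex, ha, hb] at h ⊢
    rcases h with h | ⟨h, h'⟩
    · exact Or.inl (neg_lt_neg h)
    · exact Or.inr ⟨by rw [h], neg_lt_neg h'⟩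
  obtain ⟨n, hn⟩ := exists_strictAnti_numbering hκ
  -- `bar` reverses the order of the keys, so reversing time and applying `bar` gives another
  -- strictly sorted numbering, hence the same one.
  have hrev : (Fin.revPerm.trans n).trans hbar.toPerm = n :=
    numbering_eq_of_strictAnti hκ
      (fun s t hst => hκbar _ _ (hn (Fin.rev_lt_rev.2 hst))) hn
  refine ⟨n, ?_, fun s t hst => Prod.Lex.monotone_fst _ _ (hn.antitone hst)⟩
  simp only [feasible, Finset.mem_filter, Finset.mem_univ, true_and]
  refine ⟨?_, fun m hm t ht => apply_zero_of_strictAnti hn (fun x hx => ?_) ht⟩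
  · intro bar' hbar' t
    obtain rfl : bar = bar' := by simpa using hbar'
    have := DFunLike.congr_fun hrev t.rev
    simpa using this.symm
  · rw [Prod.Lex.toLex_lt_toLex]
    rcases ((hfirst m hm).2 x).lt_or_eq with h | h
    · exact Or.inl h
    · refine Or.inr ⟨h, ?_⟩
      -- As m is not fixed and has the top rank, `b m = i m + 1` is the largest tie-breaker; a fixed
      -- letter would only get 0.
      have h1 : i (bar m) ≠ i m := fun h => (hfirst m hm).1 (hi h)
      have h2 := hmax m hm (bar m)
      have h3 : i x ≠ i m := fun h => hx (hi h)
      have h4 := hmax m hm x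
      simp only [b]
      split_ifs <;> omega

theorem sum_mul_le_of_antitone {γ : Fin (Fintype.card M) → ℝ} (hγ : Antitone γ) {a : M → ℝ}
    {n' : Numbering M} (hn' : Antitone fun t => a (n' t)) (n : Numbering M) :
    ∑ t, γ t * a (n t) ≤ ∑ t, γ t * a (n' t) := by
  have := (hγ.monovary hn').sum_mul_comp_perm_le_sum_mul (σ := n.trans n'.symm)
  simpa using this

end Sorting

/-! ### Antipodal pairings, and restriction to feasible numberings without loss. -/

section Symmetry

variable {H : Type*} [NormedAddCommGroup H] [InnerProductSpace ℂ H]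
variable {M : Type*} {G : Subgroup (Equiv.Perm M)} {σ : M → (H →ₗ[ℂ] H)}

theorem IsCovariantRep.apply_inv {R : Representation ℂ G (H →ₗ[ℂ] H)} (g : G)
    (A : H →ₗ[ℂ] H) : R g⁻¹ (R g A) = A := by
  rw [← Module.End.mul_apply, ← map_mul, inv_mul_cancel, map_one, Module.End.one_apply]

/-- The image of a finite antipodally paired alphabet determines the image of the identity, which
covariant morphisms therefore preserve. -/
theorem IsCovariantRep.apply_id [Finite M] [Nonempty M] {R : Representation ℂ G (H →ₗ[ℂ] H)}
    (hR : IsCovariantRep G σ R) {bar : M → M} (hbar : IsAntipodalPairing σ bar) (g : G) :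
    R g LinearMap.id = LinearMap.id := by
  have := Fintype.ofFinite M
  have h1 : (2 : ℂ) • ∑ m, σ m = (Fintype.card M : ℂ) • LinearMap.id := by
    have : ∑ m, (σ m + σ (bar m)) = (Fintype.card M : ℂ) • LinearMap.id := by
      simp only [hbar.2.1, Finset.sum_const, Finset.card_univ, Nat.cast_smul_eq_nsmul]
    rw [← this, Finset.sum_add_distrib, two_smul]
    congr 1
    exact (Equiv.sum_comp hbar.1.toPerm σ).symm
  have h2 : R g (∑ m, σ m) = ∑ m, σ m := by
    rw [map_sum, ← Equiv.sum_comp (g : Equiv.Perm M) σ]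
    exact Finset.sum_congr rfl fun m _ => (hR g).2 m
  have h3 := congrArg (R g) h1
  rw [map_smul, map_smul, h2, h1] at h3
  exact (smul_right_injective _ (by exact_mod_cast Fintype.card_ne_zero) h3).symm

theorem IsCovariantRep.effectValue_inv {R : Representation ℂ G (H →ₗ[ℂ] H)}
    (hR : IsCovariantRep G σ R) (g : G) {P Q : H →ₗ[ℂ] H} (h : IsEffectPair P Q) :
    ∃ P' Q', IsEffectPair P' Q' ∧
      ∀ m, effectValue P' Q' (σ m) = effectValue P Q (R g⁻¹ (σ m)) :=
  (hR g⁻¹).1.exists_effectPair h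

theorem exists_isState (hH : Module.finrank ℂ H = 2) :
    ∃ ρ : H →ₗ[ℂ] H, IsState ρ ∧ ρ ≠ (1 / 2 : ℂ) • LinearMap.id := by
  have : FiniteDimensional ℂ H := FiniteDimensional.of_finrank_pos (by omega)
  let b := (stdOrthonormalBasis ℂ H).reindex (finCongr hH)
  refine ⟨(InnerProductSpace.rankOne ℂ (b 0) (b 0)).toLinearMap,
    ⟨(InnerProductSpace.isPositive_rankOne_self _).toLinearMap, ?_⟩, fun h => ?_⟩
  · simp [tr, InnerProductSpace.trace_rankOne]
  · have h1 := LinearMap.congr_fun h (b 1)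
    have h2 : inner ℂ (b 0) (b 1) = 0 := b.orthonormal.2 (by decide)
    simp only [ContinuousLinearMap.coe_coe, InnerProductSpace.rankOne_apply, h2, zero_smul,
      LinearMap.smul_apply, LinearMap.id_apply] at h1
    have h3 : b 1 ≠ 0 := b.orthonormal.ne_zero 1
    exact (smul_ne_zero (by norm_num) h3) h1.symm

/-- On a one-letter alphabet g = 1, and central symmetry would make every state half the identity.
-/
theorem IsCentrallySymmetric.two_le_card [Fintype M] [Nonempty M]
    (hH : Module.finrank ℂ H = 2) (hCS : IsCentrallySymmetric G σ) : 2 ≤ Fintype.card M := by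
  obtain ⟨R, -, g, hg⟩ := hCS
  by_contra hlt
  have : Subsingleton M := Fintype.card_le_one_iff_subsingleton.1 (by omega)
  have hg1 : g = 1 := Subsingleton.elim _ _
  obtain ⟨ρ, hρ, hne⟩ := exists_isState hH
  have h := hg ρ hρ
  rw [hg1, map_one, Module.End.one_apply, hH, Nat.cast_ofNat, div_self two_ne_zero, one_smul] at h
  refine hne ?_
  have h2 : (2 : ℂ) • ρ = LinearMap.id := by
    rw [two_smul]
    nth_rewrite 1 [h]
    exact sub_add_cancel _ _
  rw [← h2, smul_smul]
  norm_num

/-- If the fibres of `f` over `x` and `c x` are equinumerous, then some involution with at most one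
fixed point maps each fibre over `x` to that over `c x`. -/
theorem exists_involutive_of_card_fibre_eq {X : Type*} [DecidableEq M] [DecidableEq X] {f : M → X}
    {c : X → X} (hc : Function.Involutive c) (hcfix : ∀ x y, c x = x → c y = y → x = y)
    (s : Finset M)
    (h : ∀ x, (s.filter fun m => f m = x).card = (s.filter fun m => f m = c x).card) :
    ∃ bar : M → M, (∀ m ∈ s, bar m ∈ s ∧ bar (bar m) = m ∧ f (bar m) = c (f m)) ∧
      ∀ m ∈ s, ∀ m' ∈ s, bar m = m → bar m' = m' → m = m' := by
  induction s using Finset.strongInduction with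
  | H s ih =>
    by_cases hp : ∃ a ∈ s, ∃ b ∈ s, a ≠ b ∧ f b = c (f a)
    · obtain ⟨a, ha, b, hb, hab, hfab⟩ := hp
      have hba : b ∈ s.erase a := Finset.mem_erase.2 ⟨hab.symm, hb⟩
      obtain ⟨bar, h1, h2⟩ := ih ((s.erase a).erase b)
        ((Finset.erase_subset _ _).trans_ssubset (Finset.erase_ssubset ha)) (by
          intro x
          -- Removing a and b lowers the counts over x and c x by the same amount, so the hypothesis
          -- passes to the smaller set.
          have key : ∀ y, (((s.erase a).erase b).filter fun m => f m = y).card +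
              ((if f a = y then 1 else 0) + if f b = y then 1 else 0) =
              (s.filter fun m => f m = y).card := by
            intro y
            simp only [Finset.card_filter]
            rw [← Finset.add_sum_erase s _ ha, ← Finset.add_sum_erase _ _ hba]
            ring
          have e1 : f a = x ↔ f b = c x := by rw [hfab, hc.injective.eq_iff]
          have e2 : f b = x ↔ f a = c x := by rw [hfab, hc.eq_iff]
          have k1 := key x
          have k2 := key (c x)
          have := h x
          simp only [e1, e2] at k1
          omega)
      have hne : ∀ m ∈ (s.erase a).erase b, m ≠ a ∧ m ≠ b ∧ m ∈ s := by
        intro m hm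
        simp only [Finset.mem_erase] at hm
        tauto
      have hbar : ∀ m ∈ s, m ≠ a → m ≠ b → bar m ≠ a ∧ bar m ≠ b ∧ bar m ∈ s ∧
          bar (bar m) = m ∧ f (bar m) = c (f m) := by
        intro m hm hma hmb
        obtain ⟨k1, k2, k3⟩ := h1 m (by simp [hm, hma, hmb])
        exact ⟨(hne _ k1).1, (hne _ k1).2.1, (hne _ k1).2.2, k2, k3⟩
      refine ⟨fun m => if m = a then b else if m = b then a else bar m, fun m hm => ?_, ?_⟩
      · by_cases hma : m = a
        · subst hma
          simp [hb, hab.symm, hfab]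
        · by_cases hmb : m = b
          · subst hmb
            simp [ha, hab.symm, hfab, hc (f a)]
          · have := hbar m hm hma hmb
            simp [hma, hmb, this]
      · intro m hm m' hm' hmm hmm'
        by_cases hma : m = a
        · simp [hma, hab.symm] at hmm
        by_cases hmb : m = b
        · simp [hmb, hab.symm, hab] at hmm
        by_cases hma' : m' = a
        · simp [hma', hab.symm] at hmm'
        by_cases hmb' : m' = b
        · simp [hmb', hab.symm, hab] at hmm'
        simp only [hma, hmb, hma', hmb', if_false] at hmm hmm'
        exact h2 m (by simp [hm, hma, hmb]) m' (by simp [hm', hma', hmb']) hmm hmm'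
    -- With no pair left to remove, every remaining letter lies over the only fixed point of c. Two
    -- such letters would form a pair, so at most one remains and the identity serves.
    · push Not at hp
      have hfixed : ∀ m ∈ s, c (f m) = f m := by
        intro m hm
        have hpos : 0 < (s.filter fun m' => f m' = c (f m)).card := by
          rw [← h (f m)]
          exact Finset.card_pos.2 ⟨m, by simp [hm]⟩
        obtain ⟨m', hm'⟩ := Finset.card_pos.1 hpos
        rw [Finset.mem_filter] at hm'
        have : m = m' := by
          by_contra hne
          exact hp m hm m' hm'.1 hne hm'.2
        rw [← hm'.2, this]
      refine ⟨id, fun m hm => ⟨hm, rfl, (hfixed m hm).symm⟩, fun m hm m' hm' _ _ => ?_⟩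
      by_contra hne
      refine hp m hm m' hm' hne ?_
      rw [hfixed m hm]
      exact hcfix _ _ (hfixed m' hm') (hfixed m hm)

/-- If σ is not injective, g need not act on letters as an involution and may fix several of them.
It does match the fibre of σ over A with the one over 1 - A, and equal sizes suffice. -/
theorem IsCentrallySymmetric.exists_isAntipodalPairing [Fintype M]
    (hH : Module.finrank ℂ H = 2) (hσ : IsCQChannel σ) (hCS : IsCentrallySymmetric G σ) :
    ∃ bar : M → M, IsAntipodalPairing σ bar := by
  classical
  obtain ⟨R, hR, g, hg⟩ := hCS
  have hg' : ∀ m, σ ((g : Equiv.Perm M) m) = LinearMap.id - σ m := by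
    intro m
    rw [← (hR g).2 m, hg _ (hσ m), hH, Nat.cast_ofNat, div_self two_ne_zero, one_smul]
  obtain ⟨bar, h1, h2⟩ := exists_involutive_of_card_fibre_eq (f := σ)
    (c := fun A => LinearMap.id - A) (fun A => sub_sub_cancel _ _)
    (fun A B hA hB => by
      have hA' : LinearMap.id = (2 : ℂ) • A := by rw [two_smul]; exact sub_eq_iff_eq_add.1 hA
      have hB' : LinearMap.id = (2 : ℂ) • B := by rw [two_smul]; exact sub_eq_iff_eq_add.1 hB
      exact smul_right_injective _ (two_ne_zero' ℂ) (hA'.symm.trans hB'))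
    Finset.univ (fun A => by
      refine Finset.card_equiv (g : Equiv.Perm M) fun m => ?_
      simp only [Finset.mem_filter, Finset.mem_univ, true_and, hg']
      exact sub_right_injective.eq_iff.symm)
  refine ⟨bar, fun m => (h1 m (Finset.mem_univ m)).2.1, fun m => ?_,
    fun m m' => h2 m (Finset.mem_univ m) m' (Finset.mem_univ m')⟩
  rw [(h1 m (Finset.mem_univ m)).2.2]
  exact add_sub_cancel _ _

theorem effectValue_antipodal {P Q : H →ₗ[ℂ] H} (h0 : effectValue P Q LinearMap.id = 0)
    {A B : H →ₗ[ℂ] H} (h : A + B = LinearMap.id) : effectValue P Q B = -effectValue P Q A := by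
  rw [← h, map_add] at h0
  linarith

variable [Fintype M]

/-- In a transitive channel, a numbering is scored, after relabelling, by an observable that is
maximal at any given letter. -/
theorem IsTransitive.exists_score [Nonempty M] (htrans : IsTransitive G σ)
    {P Q : H →ₗ[ℂ] H} (h : IsEffectPair P Q) (m : M) :
    ∃ R : Representation ℂ G (H →ₗ[ℂ] H), IsCovariantRep G σ R ∧ ∃ (g : G) (P' Q' : H →ₗ[ℂ] H),
      IsEffectPair P' Q' ∧ (∀ x, effectValue P' Q' (σ x) = effectValue P Q (R g⁻¹ (σ x))) ∧
      ∀ x, effectValue P' Q' (σ x) ≤ effectValue P' Q' (σ m) := by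
  obtain ⟨R, hR, hg⟩ := htrans
  obtain ⟨x, hx⟩ := Finite.exists_max fun x => effectValue P Q (σ x)
  obtain ⟨g, hg⟩ := hg x m
  obtain ⟨P', Q', h', heq⟩ := hR.effectValue_inv g h
  refine ⟨R, hR, g, P', Q', h', heq, fun y => ?_⟩
  rw [heq, heq, ← hg, IsCovariantRep.apply_inv, (hR g⁻¹).2]
  exact hx _

/-- Moving the numbering by g undoes the pull-back of the observable along g⁻¹. -/
theorem score_relabel {R : Representation ℂ G (H →ₗ[ℂ] H)} (hR : IsCovariantRep G σ R) (g : G)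
    {P Q P' Q' : H →ₗ[ℂ] H}
    (h : ∀ x, effectValue P' Q' (σ x) = effectValue P Q (R g⁻¹ (σ x)))
    (γ : Fin (Fintype.card M) → ℝ) (n : Numbering M) :
    ∑ t, γ t * effectValue P' Q' (σ (n.trans (g : Equiv.Perm M) t)) =
      ∑ t, γ t * effectValue P Q (σ (n t)) := by
  refine Finset.sum_congr rfl fun t _ => ?_
  rw [h, Equiv.trans_apply, ← (hR g).2, IsCovariantRep.apply_inv]

variable [FiniteDimensional ℂ H]

/-- Rearrangement compares the scores for one fixed observable; the trace norm then dominates the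
score of n'. -/
theorem objective_le_of_antitone {γ : Fin (Fintype.card M) → ℝ} (hγ : Antitone γ)
    (hσ : IsCQChannel σ) {P Q : H →ₗ[ℂ] H} (h : IsEffectPair P Q) {n n' : Numbering M}
    (hn' : Antitone fun t => effectValue P Q (σ (n' t))) :
    2 / (Fintype.card M : ℝ) * ∑ t, γ t * effectValue P Q (σ (n t)) ≤ objective γ σ n' :=
  (mul_le_mul_of_nonneg_left (sum_mul_le_of_antitone (a := fun m => effectValue P Q (σ m)) hγ hn' n)
    (by positivity)).trans (score_le_objective h γ hσ n')

theorem exists_feasible_first_ge [Nonempty M] (hH : Module.finrank ℂ H = 2)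
    {γ : Fin (Fintype.card M) → ℝ} (hγ : Antitone γ) (hγ0 : ∑ t, γ t = 0)
    (hσ : IsCQChannel σ) (htrans : IsTransitive G σ) (m : M) (n : Numbering M) :
    ∃ n' ∈ feasible none (some m), objective γ σ n ≤ objective γ σ n' := by
  obtain ⟨P, Q, h, -, hn⟩ := exists_score_eq_objective hH hγ0 hσ n
  obtain ⟨R, hR, g, P', Q', h', heq, hmax⟩ := htrans.exists_score h m
  obtain ⟨n', hn', hanti⟩ := exists_antitone_mem_feasible
    (fun x => effectValue P' Q' (σ x)) (first := some m) (by simpa using hmax)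
  refine ⟨n', hn', ?_⟩
  rw [← hn, ← score_relabel hR g heq]
  exact objective_le_of_antitone hγ hσ h' hanti

theorem exists_feasible_conj_ge (hH : Module.finrank ℂ H = 2)
    {γ : Fin (Fintype.card M) → ℝ} (hγ : Antitone γ) (hγ0 : ∑ t, γ t = 0)
    (hσ : IsCQChannel σ) {bar : M → M} (hbar : IsAntipodalPairing σ bar) (n : Numbering M) :
    ∃ n' ∈ feasible (some bar) none, objective γ σ n ≤ objective γ σ n' := by
  obtain ⟨P, Q, h, h0, hn⟩ := exists_score_eq_objective hH hγ0 hσ n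
  obtain ⟨n', hn', hanti⟩ := exists_antitone_mem_feasible_of_involutive hbar.1 hbar.2.2
    (a := fun x => effectValue P Q (σ x)) (fun x => effectValue_antipodal h0 (hbar.2.1 x))
    (first := none) (by simp)
  refine ⟨n', hn', ?_⟩
  rw [← hn]
  exact objective_le_of_antitone hγ hσ h hanti

theorem exists_feasible_conj_first_ge [Nonempty M] (hH : Module.finrank ℂ H = 2)
    {γ : Fin (Fintype.card M) → ℝ} (hγ : Antitone γ) (hγ0 : ∑ t, γ t = 0)
    (hσ : IsCQChannel σ) (htrans : IsTransitive G σ) {bar : M → M}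
    (hbar : IsAntipodalPairing σ bar) {m : M} (hm : bar m ≠ m) (n : Numbering M) :
    ∃ n' ∈ feasible (some bar) (some m), objective γ σ n ≤ objective γ σ n' := by
  obtain ⟨P, Q, h, h0, hn⟩ := exists_score_eq_objective hH hγ0 hσ n
  obtain ⟨R, hR, g, P', Q', h', heq, hmax⟩ := htrans.exists_score h m
  obtain ⟨n', hn', hanti⟩ := exists_antitone_mem_feasible_of_involutive hbar.1 hbar.2.2
    (a := fun x => effectValue P' Q' (σ x))
    (fun x => by
      -- Oddness is checked on the original pair: `R g⁻¹` preserves the identity, so it sends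
      -- antipodal states to antipodal operators.
      rw [heq, heq]
      refine effectValue_antipodal h0 ?_
      rw [← map_add, hbar.2.1, hR.apply_id hbar])
    (first := some m) (by simpa using ⟨hm, hmax⟩)
  refine ⟨n', hn', ?_⟩
  rw [← hn, ← score_relabel hR g heq]
  exact objective_le_of_antitone hγ hσ h' hanti

end Symmetry

/-! ### Common prefixes and the letters they determine. -/

section Prefixes

variable {M : Type*} [Fintype M] {conj : Option (M → M)} {first : Option M}

theorem mem_feasible {n : Numbering M} : n ∈ feasible conj first ↔
    (∀ bar ∈ conj, ∀ t, n t.rev = bar (n t)) ∧ ∀ m ∈ first, ∀ t, t.val = 0 → n t = m := by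
  classical
  simp [feasible]

theorem apply_eq_of_lt_commonPrefix {N : Finset (Numbering M)} {n n' : Numbering M} (hn : n ∈ N)
    (hn' : n' ∈ N) {t : Fin (Fintype.card M)} (ht : t.val < commonPrefix N) : n t = n' t := by
  classical
  exact Nat.findGreatest_spec (P := fun j => ∀ n ∈ N, ∀ n' ∈ N, ∀ t : Fin (Fintype.card M),
    t.val < j → n t = n' t) (Nat.zero_le (Fintype.card M)) (by simp) n hn n' hn' t ht

theorem exists_ne_of_not_isLeaf {N : Finset (Numbering M)} (hN : N.Nonempty) (hleaf : ¬ IsLeaf N) :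
    ∃ n ∈ N, ∃ n' ∈ N, n ≠ n' := by
  refine Finset.one_lt_card.1 ?_
  have := hN.card_pos
  unfold IsLeaf at hleaf
  omega

theorem commonPrefix_lt_card {N : Finset (Numbering M)} (hN : N.Nonempty) (hleaf : ¬ IsLeaf N) :
    commonPrefix N < Fintype.card M := by
  obtain ⟨n, hn, n', hn', hne⟩ := exists_ne_of_not_isLeaf hN hleaf
  by_contra hle
  exact hne (Equiv.ext fun t =>
    apply_eq_of_lt_commonPrefix hn hn' (t.isLt.trans_le (not_lt.1 hle)))

theorem exists_apply_commonPrefix_ne {N : Finset (Numbering M)} {t : Fin (Fintype.card M)}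
    (ht : t.val = commonPrefix N) : ∃ n ∈ N, ∃ n' ∈ N, n t ≠ n' t := by
  classical
  by_contra h
  push Not at h
  refine Nat.findGreatest_is_greatest (P := fun j => ∀ n ∈ N, ∀ n' ∈ N,
    ∀ t : Fin (Fintype.card M), t.val < j → n t = n' t) (n := Fintype.card M)
    (k := commonPrefix N + 1) (lt_of_lt_of_eq (Nat.lt_succ_self _) ?_) ?_ ?_
  · congr
  · rw [← ht]
    exact t.isLt
  · intro n hn n' hn' s hs
    rcases (Nat.lt_succ_iff.1 hs).lt_or_eq with h' | h'
    · exact apply_eq_of_lt_commonPrefix hn hn' h'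
    · rw [Fin.ext (h'.trans ht.symm)]
      exact h n hn n' hn'

/-- Excluding used letters loses no numbering. With a pairing, the prefix also determines the
letters at the mirrored times; the branching time is not one of these, since the numberings of N
disagree there. -/
theorem apply_commonPrefix_mem_available {N : Finset (Numbering M)}
    (hN : N ⊆ feasible conj first) {n : Numbering M} (hn : n ∈ N) {t : Fin (Fintype.card M)}
    (ht : t.val = commonPrefix N) : n t ∈ available conj N := by
  classical
  simp only [available, Finset.mem_filter, Finset.mem_univ, true_and]
  intro n' hn' s hs
  have hagree : n' s = n s := apply_eq_of_lt_commonPrefix hn' hn hs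
  refine ⟨fun h => ?_, fun hc h => ?_⟩
  · rw [hagree] at h
    have := n.injective h
    rw [← this] at ht
    omega
  · obtain ⟨bar, rfl⟩ := Option.isSome_iff_exists.1 hc
    have hrev : ∀ p ∈ N, p s.rev = n s.rev := by
      intro p hp
      rw [(mem_feasible.1 (hN hp)).1 bar rfl, (mem_feasible.1 (hN hn)).1 bar rfl,
        apply_eq_of_lt_commonPrefix hp hn hs]
    rw [hrev n' hn'] at h
    obtain ⟨p, hp, q, hq, hpq⟩ := exists_apply_commonPrefix_ne ht
    rw [← n.injective h, hrev p hp, hrev q hq] at hpq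
    exact hpq rfl

/-- Numberings compatible with a pairing are determined by the first half of their letters. -/
theorem eq_of_agree_half {bar : M → M}
    (hfix : ∀ m m', bar m = m → bar m' = m' → m = m') {n n' : Numbering M}
    (hn : n ∈ feasible (some bar) first) (hn' : n' ∈ feasible (some bar) first) {c : ℕ}
    (hc : Fintype.card M / 2 ≤ c) (h : ∀ t, t.val < c → n t = n' t) : n = n' := by
  have hb := (mem_feasible.1 hn).1 bar rfl
  have hb' := (mem_feasible.1 hn').1 bar rfl
  refine Equiv.ext fun t => ?_
  have ht := t.isLt
  rcases lt_trichotomy t t.rev with hlt | heq | hgt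
  · refine h t ?_
    rw [Fin.lt_def, Fin.val_rev] at hlt
    omega
  · refine hfix _ _ ?_ ?_
    · rw [← hb, ← heq]
    · rw [← hb', ← heq]
  · have hrev := h t.rev (by
      rw [Fin.lt_def, Fin.val_rev] at hgt
      rw [Fin.val_rev]
      omega)
    rw [← Fin.rev_rev t, hb, hb', hrev]

end Prefixes

/-! ### Branches as a partition into at least two parts. -/

section Branching

variable {M : Type*} [Fintype M] {conj : Option (M → M)} {first : Option M}

theorem mem_brn {N B : Finset (Numbering M)} : B ∈ brn conj N ↔ B.Nonempty ∧
    ∃ m ∈ available conj N, ∀ n, n ∈ B ↔ n ∈ N ∧ ∃ t, t.val = commonPrefix N ∧ n t = m := by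
  classical
  simp only [brn, Finset.mem_erase, Finset.mem_image, Finset.nonempty_iff_ne_empty]
  refine and_congr_right fun _ => exists_congr fun m => and_congr_right fun _ => ?_
  constructor
  · rintro rfl n
    simp
  · intro h
    ext n
    simp [h]

theorem nonempty_of_mem_brn {N B : Finset (Numbering M)} (h : B ∈ brn conj N) : B.Nonempty :=
  (mem_brn.1 h).1

theorem subset_of_mem_brn {N B : Finset (Numbering M)} (h : B ∈ brn conj N) : B ⊆ N := by
  obtain ⟨-, m, -, hm⟩ := mem_brn.1 h
  exact fun n hn => ((hm n).1 hn).1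

theorem eq_of_mem_brn {N B B' : Finset (Numbering M)} (h : B ∈ brn conj N) (h' : B' ∈ brn conj N)
    {n : Numbering M} (hn : n ∈ B) (hn' : n ∈ B') : B = B' := by
  obtain ⟨-, m, -, hm⟩ := mem_brn.1 h
  obtain ⟨-, m', -, hm'⟩ := mem_brn.1 h'
  obtain ⟨-, t, ht, rfl⟩ := (hm n).1 hn
  obtain ⟨-, t', ht', rfl⟩ := (hm' n).1 hn'
  obtain rfl : t = t' := Fin.ext (ht.trans ht'.symm)
  ext p
  rw [hm, hm']

theorem exists_mem_brn {N : Finset (Numbering M)} (hN : N ⊆ feasible conj first)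
    (hlt : commonPrefix N < Fintype.card M) {n : Numbering M} (hn : n ∈ N) :
    ∃ B ∈ brn conj N, n ∈ B := by
  classical
  let B := N.filter fun p => ∃ t, t.val = commonPrefix N ∧ p t = n ⟨commonPrefix N, hlt⟩
  have hnB : n ∈ B := Finset.mem_filter.2 ⟨hn, ⟨commonPrefix N, hlt⟩, rfl, rfl⟩
  exact ⟨B, mem_brn.2 ⟨⟨n, hnB⟩, _, apply_commonPrefix_mem_available hN hn rfl,
    fun p => Finset.mem_filter⟩, hnB⟩

theorem sum_card_brn {N : Finset (Numbering M)} (hN : N ⊆ feasible conj first)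
    (hlt : commonPrefix N < Fintype.card M) : ∑ B ∈ brn conj N, B.card = N.card := by
  classical
  have hU : N = (brn conj N).biUnion id := by
    ext n
    simp only [Finset.mem_biUnion, id]
    exact ⟨fun hn => exists_mem_brn hN hlt hn, fun ⟨B, hB, hn⟩ => subset_of_mem_brn hB hn⟩
  conv_rhs => rw [hU]
  rw [Finset.card_biUnion]
  · rfl
  · exact fun B hB B' hB' hne => Finset.disjoint_left.2 fun n hn hn' =>
      hne (eq_of_mem_brn hB hB' hn hn')

theorem two_le_card_brn {N : Finset (Numbering M)} (hN : N ⊆ feasible conj first)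
    (hlt : commonPrefix N < Fintype.card M) : 2 ≤ (brn conj N).card := by
  obtain ⟨n, hn, n', hn', hne⟩ := exists_apply_commonPrefix_ne
    (N := N) (t := ⟨commonPrefix N, hlt⟩) rfl
  obtain ⟨B, hB, hnB⟩ := exists_mem_brn hN hlt hn
  obtain ⟨B', hB', hnB'⟩ := exists_mem_brn hN hlt hn'
  refine Finset.one_lt_card.2 ⟨B, hB, B', hB', ?_⟩
  rintro rfl
  obtain ⟨-, m, -, hm⟩ := mem_brn.1 hB
  obtain ⟨-, t, ht, rfl⟩ := (hm n).1 hnB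
  obtain ⟨-, t', ht', h⟩ := (hm n').1 hnB'
  obtain rfl : t = ⟨commonPrefix N, hlt⟩ := Fin.ext ht
  obtain rfl : t' = ⟨commonPrefix N, hlt⟩ := Fin.ext ht'
  exact hne h.symm

end Branching

/-! ### Sizes of the feasible sets. -/

section Counting

variable {M : Type*} [Fintype M] {first : Option M}

/-- With j letters settled, r remain for the next time, and each choice leaves the same problem with
r - 1. -/
theorem card_le_factorial (N : Finset (Numbering M)) (r j : ℕ) (hj : Fintype.card M = j + r)
    (h : ∀ n ∈ N, ∀ n' ∈ N, ∀ t, t.val < j → n t = n' t) : N.card ≤ r.factorial := by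
  classical
  induction r generalizing N j with
  | zero =>
    rw [Nat.factorial_zero, Finset.card_le_one]
    exact fun n hn n' hn' => Equiv.ext fun t => h n hn n' hn' t (by have := t.isLt; omega)
  | succ r ih =>
    rcases N.eq_empty_or_nonempty with rfl | ⟨n₀, hn₀⟩
    · simp
    let t₀ : Fin (Fintype.card M) := ⟨j, by omega⟩
    have h1 := Finset.card_le_mul_card_image (f := fun n : Numbering M => n t₀) N r.factorial
      (fun m _ => ih _ (j + 1) (by omega) (by
        intro n hn n' hn' t ht
        simp only [Finset.mem_filter] at hn hn'
        rcases (Nat.lt_succ_iff.1 ht).lt_or_eq with h' | h'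
        · exact h n hn.1 n' hn'.1 t h'
        · rw [show t = t₀ from Fin.ext h', hn.2, hn'.2]))
    let used := (Finset.univ.filter fun t : Fin (Fintype.card M) => t.val < j).map n₀.toEmbedding
    have h2 : N.image (fun n => n t₀) ⊆ usedᶜ := by
      intro m hm
      obtain ⟨n, hn, rfl⟩ := Finset.mem_image.1 hm
      simp only [used, Finset.mem_compl, Finset.mem_map, Finset.mem_filter, Finset.mem_univ,
        true_and, not_exists, not_and, Equiv.coe_toEmbedding]
      intro t ht heq
      rw [h n₀ hn₀ n hn t ht] at heq
      rw [n.injective heq] at ht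
      exact lt_irrefl _ ht
    have h3 : used.card = j := by
      rw [Finset.card_map, Fin.card_filter_val_lt]
      omega
    have h4 := Finset.card_le_card h2
    rw [Finset.card_compl, h3] at h4
    rw [Nat.factorial_succ, mul_comm]
    exact h1.trans (Nat.mul_le_mul_left _ (by omega))

/-- Each letter chosen also settles the mirrored time, so the number of free letters drops by two
per choice. -/
theorem card_le_doubleFactorial {bar : M → M}
    (hfix : ∀ m m', bar m = m → bar m' = m' → m = m') (N : Finset (Numbering M))
    (hN : N ⊆ feasible (some bar) first) (r j : ℕ) (hj : Fintype.card M = 2 * j + r)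
    (h : ∀ n ∈ N, ∀ n' ∈ N, ∀ t, t.val < j → n t = n' t) : N.card ≤ r.doubleFactorial := by
  classical
  -- Covers both base cases; for r = 1 the middle letter must be the fixed point of `bar`, which is
  -- unique.
  have hle : Fintype.card M / 2 ≤ j → N.card ≤ 1 := fun hc =>
    Finset.card_le_one.2 fun n hn n' hn' => eq_of_agree_half hfix (hN hn) (hN hn') hc
      (h n hn n' hn')
  induction r using Nat.twoStepInduction generalizing N j with
  | zero => exact hle (by omega)
  | one => exact hle (by omega)
  | more r ih _ =>
    rcases N.eq_empty_or_nonempty with rfl | ⟨n₀, hn₀⟩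
    · simp
    let t₀ : Fin (Fintype.card M) := ⟨j, by omega⟩
    have h1 := Finset.card_le_mul_card_image (f := fun n : Numbering M => n t₀) N r.doubleFactorial
      (fun m _ => by
        have hagree : ∀ n ∈ N.filter (fun n => n t₀ = m), ∀ n' ∈ N.filter (fun n => n t₀ = m),
            ∀ t : Fin (Fintype.card M), t.val < j + 1 → n t = n' t := by
          intro n hn n' hn' t ht
          simp only [Finset.mem_filter] at hn hn'
          rcases (Nat.lt_succ_iff.1 ht).lt_or_eq with h' | h'
          · exact h n hn.1 n' hn'.1 t h'
          · rw [show t = t₀ from Fin.ext h', hn.2, hn'.2]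
        have hsub := (Finset.filter_subset (fun n => n t₀ = m) N).trans hN
        exact ih _ hsub (j + 1) (by omega) hagree fun hc =>
          Finset.card_le_one.2 fun n hn n' hn' =>
            eq_of_agree_half hfix (hsub hn) (hsub hn') hc (hagree n hn n' hn'))
    let early := Finset.univ.filter fun t : Fin (Fintype.card M) => t.val < j
    let used := (early ∪ early.map Fin.revPerm.toEmbedding).map n₀.toEmbedding
    have h2 : N.image (fun n => n t₀) ⊆ usedᶜ := by
      intro m hm
      obtain ⟨n, hn, rfl⟩ := Finset.mem_image.1 hm
      have hrev : ∀ t : Fin (Fintype.card M), t.val < j → n₀ t.rev = n t.rev := by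
        intro t ht
        rw [(mem_feasible.1 (hN hn₀)).1 bar rfl, (mem_feasible.1 (hN hn)).1 bar rfl,
          h n₀ hn₀ n hn t ht]
      simp only [used, early, Finset.mem_compl, Finset.mem_map, Finset.mem_union,
        Finset.mem_filter, Finset.mem_univ, true_and, not_exists, not_and, Equiv.coe_toEmbedding,
        Fin.revPerm_apply]
      rintro t (ht | ⟨s, hs, rfl⟩) heq
      · rw [h n₀ hn₀ n hn t ht] at heq
        rw [n.injective heq] at ht
        exact lt_irrefl _ ht
      · rw [hrev s hs] at heq
        have := congrArg Fin.val (n.injective heq)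
        rw [Fin.val_rev] at this
        simp only [t₀] at this
        omega
    have h3 : used.card = 2 * j := by
      rw [Finset.card_map, Finset.card_union_of_disjoint, Finset.card_map, Fin.card_filter_val_lt]
      · omega
      · refine Finset.disjoint_left.2 fun t ht ht' => ?_
        simp only [early, Finset.mem_map, Finset.mem_filter, Finset.mem_univ, true_and,
          Equiv.coe_toEmbedding, Fin.revPerm_apply] at ht ht'
        obtain ⟨s, hs, rfl⟩ := ht'
        rw [Fin.val_rev] at ht
        omega
    have h4 := Finset.card_le_card h2
    rw [Finset.card_compl, h3] at h4
    rw [Nat.doubleFactorial_add_two, mul_comm]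
    exact h1.trans (Nat.mul_le_mul_left _ (by omega))

theorem apply_eq_of_mem_feasible_of_val_lt_one {conj : Option (M → M)} {m : M} {n n' : Numbering M}
    (hn : n ∈ feasible conj (some m)) (hn' : n' ∈ feasible conj (some m))
    {t : Fin (Fintype.card M)} (ht : t.val < 1) : n t = n' t := by
  rw [(mem_feasible.1 hn).2 m rfl t (by omega), (mem_feasible.1 hn').2 m rfl t (by omega)]

end Counting

/-! ### Validity of the bounding rule. -/

section Bounding

variable {H : Type*} [NormedAddCommGroup H] [InnerProductSpace ℂ H] [FiniteDimensional ℂ H]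
variable {M : Type*} [Fintype M] {conj : Option (M → M)} {first : Option M}

/-- The prefix is tested as one operator, hence the trace norm; the later letters are unknown and
each is estimated by an effect value of modulus at most one. -/
theorem sum_score_le {P Q : H →ₗ[ℂ] H} (h : IsEffectPair P Q) {σ : M → (H →ₗ[ℂ] H)}
    (hσ : IsCQChannel σ) (γ : Fin (Fintype.card M) → ℝ) (n : Numbering M) {c k : ℕ} (hck : c ≤ k) :
    ∑ t with t.val < k, γ t * effectValue P Q (σ (n t)) ≤
      traceNorm (∑ t with t.val < c, ((γ t : ℝ) : ℂ) • σ (n t)) +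
        ∑ t with c ≤ t.val ∧ t.val < k, |γ t| := by
  classical
  have hsplit : (Finset.univ.filter fun t : Fin (Fintype.card M) => t.val < k) =
      (Finset.univ.filter fun t => t.val < c) ∪
        Finset.univ.filter fun t => c ≤ t.val ∧ t.val < k := by
    ext t
    simp only [Finset.mem_filter, Finset.mem_univ, true_and, Finset.mem_union]
    omega
  rw [hsplit, Finset.sum_union]
  · refine add_le_add ?_ (Finset.sum_le_sum fun t _ => ?_)
    · have := re_tr_sub_comp_le_traceNorm h (isSymmetric_sum_smul
        (Finset.univ.filter fun t : Fin (Fintype.card M) => t.val < c) γ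
        fun t _ => (hσ (n t)).1.isSymmetric)
      rw [← effectValue_apply, map_sum] at this
      simpa only [Complex.coe_smul, map_smul, smul_eq_mul] using this
    · refine (le_abs_self _).trans ?_
      rw [abs_mul]
      exact mul_le_of_le_one_right (abs_nonneg _) (abs_re_tr_sub_comp_le_one h (hσ _))
  · refine Finset.disjoint_filter.2 fun t _ ht => ?_
    omega

/-- For odd N the middle index lies in neither half, so its term has to vanish. -/
theorem sum_eq_two_mul_sum_half {N : ℕ} {f : Fin N → ℝ} (hrev : ∀ t, f t.rev = f t)
    (hmid : ∀ t, t.rev = t → f t = 0) :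
    ∑ t, f t = 2 * ∑ t with t.val < N / 2, f t := by
  have h1 : ∀ t, f t = (if t.val < N / 2 then f t else 0) +
      if t.rev.val < N / 2 then f t.rev else 0 := by
    intro t
    have ht := t.isLt
    have hr := hrev t
    have hv := Fin.val_rev t
    by_cases heq : t.rev = t
    · simp [heq, hmid t heq]
    · have : t.rev.val ≠ t.val := fun h => heq (Fin.ext h)
      split_ifs
      · omega
      · simp
      · simp [hr]
      · omega
  have h2 := Equiv.sum_comp Fin.revPerm fun t => if t.val < N / 2 then f t else 0
  simp only [Fin.revPerm_apply] at h2
  rw [Finset.sum_congr rfl fun t _ => h1 t, Finset.sum_add_distrib, h2, Finset.sum_filter]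
  ring

/-- The bounding rule is an upper bound on the objective function, except possibly on leaves. -/
theorem objective_le_bnd [Nonempty M] (hH : Module.finrank ℂ H = 2)
    {γ : Fin (Fintype.card M) → ℝ} (hγ0 : ∑ t, γ t = 0) (hγrev : ∀ t, γ t + γ t.rev = 0)
    {σ : M → (H →ₗ[ℂ] H)} (hσ : IsCQChannel σ) (hconj : ∀ bar ∈ conj, IsAntipodalPairing σ bar)
    {N : Finset (Numbering M)} (hN : N ⊆ feasible conj first) (hleaf : ¬ IsLeaf N)
    {n : Numbering M} (hn : n ∈ N) : objective γ σ n ≤ bnd γ σ conj N := by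
  have hne : N.Nonempty := ⟨n, hn⟩
  have hlt := commonPrefix_lt_card hne hleaf
  obtain ⟨P, Q, h, h0, hobj⟩ := exists_score_eq_objective hH hγ0 hσ n
  set S := ∑ t, γ t * effectValue P Q (σ (n t))
  have hcard : 2 ≤ Fintype.card M := by
    by_contra hc
    have : Subsingleton M := Fintype.card_le_one_iff_subsingleton.1 (by omega)
    obtain ⟨p, hp, q, hq, hpq⟩ := exists_ne_of_not_isLeaf hne hleaf
    exact hpq (Equiv.ext fun t => Subsingleton.elim _ _)
  have hcard' : (2 : ℝ) ≤ Fintype.card M := by exact_mod_cast hcard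
  -- `bnd` lacks the factor 2/|M| of the objective. Dropping it only enlarges the nonnegative score,
  -- since a non-leaf forces |M| ≥ 2.
  have hdiv : 2 / (Fintype.card M : ℝ) ≤ 1 := (div_le_one (by linarith)).2 hcard'
  have hpos : 0 < 2 / (Fintype.card M : ℝ) := by positivity
  have hS0 : 0 ≤ S := by
    have : 0 ≤ 2 / (Fintype.card M : ℝ) * S := hobj ▸ traceNorm_nonneg _
    exact nonneg_of_mul_nonneg_right this hpos
  have hS : objective γ σ n ≤ S := by
    rw [← hobj]
    exact mul_le_of_le_one_left hS0 hdiv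
  have hpre : ∑ t with t.val < commonPrefix N, ((γ t : ℝ) : ℂ) • σ (hne.choose t) =
      ∑ t with t.val < commonPrefix N, ((γ t : ℝ) : ℂ) • σ (n t) := by
    refine Finset.sum_congr rfl fun t ht => ?_
    rw [apply_eq_of_lt_commonPrefix hne.choose_spec hn (Finset.mem_filter.1 ht).2]
  refine hS.trans ?_
  cases conj with
  | none =>
    have := sum_score_le h hσ γ n hlt.le
    simp only [Fin.is_lt, Finset.filter_true, and_true] at this
    simpa only [bnd, Option.isSome_none, Bool.false_eq_true, if_false, hne, dif_pos, hpre, pow_zero,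
      Nat.div_one, Nat.cast_zero, zero_add, one_mul, Fin.is_lt, and_true] using this
  | some bar =>
    have hbar := hconj bar rfl
    have hfeas := (mem_feasible.1 (hN hn)).1 bar rfl
    -- A prefix longer than half the alphabet would determine the numbering and make N a leaf.
    have hhalf : commonPrefix N ≤ Fintype.card M / 2 := by
      by_contra hc
      obtain ⟨p, hp, q, hq, hpq⟩ := exists_ne_of_not_isLeaf hne hleaf
      exact hpq (eq_of_agree_half hbar.2.2 (hN hp) (hN hq) (not_le.1 hc).le fun t ht =>
        apply_eq_of_lt_commonPrefix hp hq ht)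
    have hSeq : S = 2 * ∑ t with t.val < Fintype.card M / 2, γ t * effectValue P Q (σ (n t)) := by
      refine sum_eq_two_mul_sum_half (f := fun t => γ t * effectValue P Q (σ (n t)))
        (fun t => ?_) (fun t ht => ?_)
      · rw [hfeas, effectValue_antipodal h0 (hbar.2.1 (n t)), eq_neg_of_add_eq_zero_right (hγrev t)]
        ring
      -- At the middle time, balance gives 2γ(t) = 0.
      · have := hγrev t
        rw [ht] at this
        rw [show γ t = 0 by linarith, zero_mul]
    have := sum_score_le h hσ γ n hhalf
    rw [hSeq]
    simp only [bnd, Option.isSome_some, if_true, hne, dif_pos, hpre, pow_one, Nat.cast_one]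
    linarith

end Bounding

/-! ### Correctness and running time of the search. -/

section Algorithm

variable {M : Type*} [Fintype M]
variable {H : Type*} [NormedAddCommGroup H] [InnerProductSpace ℂ H] [FiniteDimensional ℂ H]

/-- Invariant of the search, where `F` is the feasible set and `D` counts the subsets disposed of:
the pool is a family of disjoint nonempty subsets of `F`, the numberings outside the pool are no
better than the incumbent, and the counters are controlled by the sizes of the subsets. -/
structure SearchInvariant (F : Finset (Numbering M)) (f : Numbering M → ℝ) (C T B D : ℕ)
    (s : SearchState M) : Prop where
  subset : ∀ N ∈ s.pool, N ⊆ F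
  nonempty : ∀ N ∈ s.pool, N.Nonempty
  disjoint : ∀ N ∈ s.pool, ∀ N' ∈ s.pool, ∀ n ∈ N, n ∈ N' → N = N'
  dominated : ∀ n ∈ F, (∃ N ∈ s.pool, n ∈ N) ∨ ∃ b, s.best = some b ∧ f n ≤ f b
  size : D + ∑ N ∈ s.pool, N.card ≤ F.card
  -- A branching enlarges the pool by at least one; a disposal moves one unit from the pool to D.
  branchings : B + 1 ≤ D + s.pool.card
  -- Every round disposes of C subsets, except that the one emptying the pool may handle fewer, but
  -- at least one.
  rounds : C * T < D + C
  rounds_of_nonempty : s.pool.Nonempty → D = C * T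

theorem SearchInvariant.start {F : Finset (Numbering M)} (hF : F.Nonempty) (f : Numbering M → ℝ)
    {C : ℕ} (hC : 0 < C) : SearchInvariant F f C 0 0 0 ⟨{F}, none⟩ where
  subset := by simp
  nonempty := by simpa using hF
  disjoint := by simp
  dominated := fun n hn => Or.inl ⟨F, by simp, hn⟩
  size := by simp
  branchings := by simp
  rounds := by simpa using hC
  rounds_of_nonempty := by simp

variable {γ : Fin (Fintype.card M) → ℝ} {σ : M → (H →ₗ[ℂ] H)} {conj : Option (M → M)}
  {first : Option M} {C T B D : ℕ} {s s' : SearchState M}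

theorem SearchInvariant.branch
    (h : SearchInvariant (feasible conj first) (objective γ σ) C T B D s)
    (hs : BranchStep γ σ conj s s') :
    SearchInvariant (feasible conj first) (objective γ σ) C T (B + 1) D s' := by
  classical
  obtain ⟨N, hN, hleaf, -, rfl⟩ := hs
  have hNF := h.subset N hN
  have hlt := commonPrefix_lt_card (h.nonempty N hN) hleaf
  have hdisj : Disjoint (s.pool.erase N) (brn conj N) := by
    refine Finset.disjoint_left.2 fun P hP hP' => ?_
    rw [Finset.mem_erase] at hP
    obtain ⟨n, hn⟩ := h.nonempty P hP.2
    exact hP.1 (h.disjoint P hP.2 N hN n hn (subset_of_mem_brn hP' hn))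
  have hcard := Finset.card_erase_add_one hN
  have hsum := Finset.sum_erase_add s.pool Finset.card hN
  have hbrn := sum_card_brn hNF hlt
  have hbrn2 := two_le_card_brn hNF hlt
  have hmem : ∀ {P}, P ∈ s.pool.erase N ∪ brn conj N ↔
      (P ≠ N ∧ P ∈ s.pool) ∨ P ∈ brn conj N := by
    intro P
    rw [Finset.mem_union, Finset.mem_erase]
  constructor
  · intro P hP
    rcases hmem.1 hP with hP | hP
    · exact h.subset P hP.2
    · exact (subset_of_mem_brn hP).trans hNF
  · intro P hP
    rcases hmem.1 hP with hP | hP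
    · exact h.nonempty P hP.2
    · exact nonempty_of_mem_brn hP
  · intro P hP P' hP' n hn hn'
    rcases hmem.1 hP with hP | hP <;> rcases hmem.1 hP' with hP' | hP'
    · exact h.disjoint P hP.2 P' hP'.2 n hn hn'
    · exact absurd (h.disjoint P hP.2 N hN n hn (subset_of_mem_brn hP' hn')) hP.1
    · exact absurd (h.disjoint P' hP'.2 N hN n hn' (subset_of_mem_brn hP hn)) hP'.1
    · exact eq_of_mem_brn hP hP' hn hn'
  · intro n hn
    refine (h.dominated n hn).imp_left fun ⟨P, hP, hnP⟩ => ?_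
    by_cases hPN : P = N
    · subst hPN
      obtain ⟨Q, hQ, hnQ⟩ := exists_mem_brn hNF hlt hnP
      exact ⟨Q, hmem.2 (Or.inr hQ), hnQ⟩
    · exact ⟨P, hmem.2 (Or.inl ⟨hPN, hP⟩), hnP⟩
  · have := h.size
    dsimp only
    rw [Finset.sum_union hdisj]
    omega
  · have := h.branchings
    dsimp only
    rw [Finset.card_union_of_disjoint hdisj]
    omega
  · exact h.rounds
  · exact fun _ => h.rounds_of_nonempty ⟨N, hN⟩

theorem SearchInvariant.round
    (hbnd : ∀ N ⊆ feasible conj first, ¬ IsLeaf N → ∀ n ∈ N, objective γ σ n ≤ bnd γ σ conj N)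
    (h : SearchInvariant (feasible conj first) (objective γ σ) C T B D s)
    (hs : RoundStep γ σ conj C s s') :
    ∃ D', SearchInvariant (feasible conj first) (objective γ σ) C (T + 1) B D' s' := by
  classical
  obtain ⟨L, hL, hLne, hLdisp, hLcard, n₀, -, hmax, rfl⟩ := hs
  have hmem : ∀ {P}, P ∈ s.pool \ L ↔ P ∈ s.pool ∧ P ∉ L := Finset.mem_sdiff
  have hbest : ∀ b, s.best = some b → objective γ σ b ≤ objective γ σ n₀ := by
    intro b hb
    exact hmax b (Finset.mem_union_left _ (by simp [hb]))
  have hpos := hLne.card_pos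
  have hD := h.rounds_of_nonempty (hLne.mono hL)
  have hcard := Finset.card_sdiff_add_card_eq_card hL
  have hsum := Finset.sum_sdiff (f := Finset.card) hL
  -- Each disposed subset is nonempty, so the numberings leaving the pool pay for the increase of D.
  have hLsum : L.card ≤ ∑ N ∈ L, N.card := by
    rw [Finset.card_eq_sum_ones]
    exact Finset.sum_le_sum fun N hN => (h.nonempty N (hL hN)).card_pos
  refine ⟨D + L.card, ?_⟩
  constructor
  · exact fun P hP => h.subset P (hmem.1 hP).1
  · exact fun P hP => h.nonempty P (hmem.1 hP).1
  · exact fun P hP P' hP' => h.disjoint P (hmem.1 hP).1 P' (hmem.1 hP').1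
  · intro n hn
    rcases h.dominated n hn with ⟨P, hP, hnP⟩ | ⟨b, hb, hnb⟩
    · by_cases hPL : P ∈ L
      · refine Or.inr ⟨n₀, rfl, ?_⟩
        by_cases hleaf : IsLeaf P
        · exact hmax n (Finset.mem_union_right _ (Finset.mem_biUnion.2
            ⟨P, Finset.mem_filter.2 ⟨hPL, hleaf⟩, hnP⟩))
        · obtain ⟨b, hb, hle⟩ := (hLdisp P hPL).resolve_left hleaf
          exact (hbnd P (h.subset P hP) hleaf n hnP).trans (hle.trans (hbest b hb))
      · exact Or.inl ⟨P, hmem.2 ⟨hP, hPL⟩, hnP⟩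
    · exact Or.inr ⟨n₀, rfl, hnb.trans (hbest b hb)⟩
  · have := h.size
    dsimp only
    omega
  · have := h.branchings
    dsimp only
    omega
  · rw [mul_add, ← hD]
    omega
  · rintro ⟨P, hP⟩
    rw [mul_add, ← hD, mul_one]
    rcases hLcard with hLC | ⟨-, rfl⟩
    · rw [hLC]
    · simp at hP

theorem Run.exists_searchInvariant (hF : (feasible conj first).Nonempty) (hC : 0 < C)
    (hbnd : ∀ N ⊆ feasible conj first, ¬ IsLeaf N → ∀ n ∈ N, objective γ σ n ≤ bnd γ σ conj N)
    (h : Run γ σ conj first C T B s) :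
    ∃ D, SearchInvariant (feasible conj first) (objective γ σ) C T B D s := by
  induction h with
  | start => exact ⟨0, SearchInvariant.start hF _ hC⟩
  | branch _ hs ih =>
    obtain ⟨D, hD⟩ := ih
    exact ⟨D, hD.branch hs⟩
  | round _ hs ih =>
    obtain ⟨D, hD⟩ := ih
    exact hD.round hbnd hs

/-- The search cannot get stuck. -/
theorem exists_step (hC : 0 < C) (hne : ∀ N ∈ s.pool, N.Nonempty) (hs : s.pool ≠ ∅) :
    ∃ s', BranchStep γ σ conj s s' ∨ RoundStep γ σ conj C s s' := by
  classical
  by_cases hb : ∃ N ∈ s.pool, ¬ IsLeaf N ∧ ¬ Prunable γ σ conj s N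
  · obtain ⟨N, hN, hleaf, hpr⟩ := hb
    exact ⟨_, Or.inl ⟨N, hN, hleaf, hpr, rfl⟩⟩
  have hdisp : ∀ N ∈ s.pool, IsLeaf N ∨ Prunable γ σ conj s N := by
    intro N hN
    by_contra h
    rw [not_or] at h
    exact hb ⟨N, hN, h⟩
  have hpos : 0 < s.pool.card := Finset.card_pos.2 (Finset.nonempty_iff_ne_empty.2 hs)
  -- If no branching is possible, every subset in the pool can be disposed of, so a round may take
  -- any min(C, |pool|) of them.
  obtain ⟨L, hL, hLcard⟩ := Finset.exists_subset_card_eq (min_le_right C s.pool.card)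
  have hLne : L.Nonempty := Finset.card_pos.1 (by omega)
  have hcand : (s.best.toFinset ∪ (L.filter IsLeaf).biUnion id).Nonempty := by
    obtain ⟨N, hN⟩ := hLne
    rcases hdisp N (hL hN) with hleaf | ⟨b, hb, -⟩
    · obtain ⟨n, hn⟩ := hne N (hL hN)
      exact ⟨n, Finset.mem_union_right _ (Finset.mem_biUnion.2
        ⟨N, Finset.mem_filter.2 ⟨hN, hleaf⟩, hn⟩)⟩
    · exact ⟨b, Finset.mem_union_left _ (by simp [hb])⟩
  obtain ⟨n, hn, hmax⟩ := Finset.exists_max_image _ (objective γ σ) hcand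
  refine ⟨⟨s.pool \ L, some n⟩, Or.inr ⟨L, hL, hLne, fun N hN => hdisp N (hL hN), ?_, n, ?_⟩⟩
  · rcases le_or_gt C s.pool.card with h | h
    · exact Or.inl (by omega)
    · exact Or.inr ⟨by omega, Finset.eq_of_subset_of_card_le hL (by omega)⟩
  · refine ⟨?_, ?_, rfl⟩
    · convert hn
    · intro n' hn'
      refine hmax n' ?_
      convert hn'

/-- Branch and bound over a feasible set that reaches the maximum of the objective function is
correct, in time controlled by the size of the feasible set. -/
theorem computesMinGuesswork [Nonempty M] (hH : Module.finrank ℂ H = 2)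
    {γ : Fin (Fintype.card M) → ℝ} (hbal : IsBalanced γ) {σ : M → (H →ₗ[ℂ] H)}
    (hσ : IsCQChannel σ) {conj : Option (M → M)} {first : Option M}
    (hconj : ∀ bar ∈ conj, IsAntipodalPairing σ bar) {C W : ℕ} (hC : 0 < C)
    (hW : (feasible conj first).card ≤ W)
    (hfeas : ∀ n, ∃ n' ∈ feasible conj first,
      objective (centred γ) σ n ≤ objective (centred γ) σ n') :
    ComputesMinGuesswork γ σ conj first C W := by
  intro T B s hrun
  have hF : (feasible conj first).Nonempty := by
    obtain ⟨n, hn, -⟩ := hfeas (Fintype.equivFin M).symm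
    exact ⟨n, hn⟩
  obtain ⟨D, h⟩ := hrun.exists_searchInvariant hF hC fun N hN hleaf n hn =>
    objective_le_bnd hH (sum_centred γ) (centred_add_rev hbal) hσ hconj hN hleaf hn
  have hsize := h.size
  refine ⟨?_, ?_, exists_step hC h.nonempty, fun hs => ?_⟩
  · rcases T with _ | T
    · exact Nat.zero_le _
    · rw [Nat.succ_le_iff, Nat.lt_ceil, lt_div_iff₀ (by exact_mod_cast hC)]
      have := h.rounds
      have hlt : T * C < W := by
        rw [mul_add, mul_one] at this
        rw [mul_comm]
        omega
      exact_mod_cast hlt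
  · have := h.branchings
    have hle : s.pool.card ≤ ∑ N ∈ s.pool, N.card := by
      rw [Finset.card_eq_sum_ones]
      exact Finset.sum_le_sum fun N hN => (h.nonempty N hN).card_pos
    omega
  · have hdom : ∀ n ∈ feasible conj first, ∃ b, s.best = some b ∧
        objective (centred γ) σ n ≤ objective (centred γ) σ b :=
      fun n hn => (h.dominated n hn).resolve_left (by simp [hs])
    obtain ⟨n₀, hn₀⟩ := hF
    obtain ⟨b, hb, -⟩ := hdom n₀ hn₀
    refine ⟨b, hb, isMinGuesswork_of_forall_objective_le hH hbal hσ fun n => ?_⟩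
    obtain ⟨n', hn', hle⟩ := hfeas n
    obtain ⟨b', hb', hle'⟩ := hdom n' hn'
    obtain rfl : b = b' := Option.some_injective _ (hb.symm.trans hb')
    exact hle.trans hle'

end Algorithm

end Guesswork

theorem theorem1 {M : Type*} [Fintype M] [Nonempty M]
    {H : Type*} [NormedAddCommGroup H] [InnerProductSpace ℂ H] [FiniteDimensional ℂ H]
    (hH : Module.finrank ℂ H = 2)
    (γ : Fin (Fintype.card M) → ℝ) (hmono : Antitone γ) (hbal : Guesswork.IsBalanced γ)
    (G : Subgroup (Equiv.Perm M)) (σ : M → (H →ₗ[ℂ] H))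
    (hσ : Guesswork.IsCQChannel σ) (hcov : Guesswork.IsCovariant G σ)
    (C : ℕ) (hC : 0 < C) :
    Guesswork.ComputesMinGuesswork γ σ none none C (Fintype.card M).factorial ∧
    (Guesswork.IsTransitive G σ → ∀ m : M,
      Guesswork.ComputesMinGuesswork γ σ none (some m) C (Fintype.card M - 1).factorial) ∧
    (Guesswork.IsCentrallySymmetric G σ →
      (∃ bar : M → M, Guesswork.IsAntipodalPairing σ bar) ∧
      ∀ bar : M → M, Guesswork.IsAntipodalPairing σ bar →
        Guesswork.ComputesMinGuesswork γ σ (some bar) none C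
          (Fintype.card M).doubleFactorial) ∧
    (Guesswork.IsTransitive G σ → Guesswork.IsCentrallySymmetric G σ →
      2 ≤ Fintype.card M ∧
      ∀ bar : M → M, Guesswork.IsAntipodalPairing σ bar → ∀ m : M, bar m ≠ m →
        Guesswork.ComputesMinGuesswork γ σ (some bar) (some m) C
          (Fintype.card M - 2).doubleFactorial) := by
  have hanti := Guesswork.antitone_centred hmono
  have hsum := Guesswork.sum_centred γ
  have hpos : 0 < Fintype.card M := Fintype.card_pos
  refine ⟨?_, fun htrans m => ?_, fun hCS => ⟨hCS.exists_isAntipodalPairing hH hσ, ?_⟩,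
    fun htrans hCS => ⟨hCS.two_le_card hH, ?_⟩⟩
  · refine Guesswork.computesMinGuesswork hH hbal hσ (by simp) hC ?_
      fun n => ⟨n, by simp [Guesswork.mem_feasible], le_rfl⟩
    exact Guesswork.card_le_factorial _ _ 0 (by omega) (by simp)
  · refine Guesswork.computesMinGuesswork hH hbal hσ (by simp) hC ?_
      (Guesswork.exists_feasible_first_ge hH hanti hsum hσ htrans m)
    exact Guesswork.card_le_factorial _ _ 1 (by omega) fun n hn n' hn' t ht =>
      Guesswork.apply_eq_of_mem_feasible_of_val_lt_one hn hn' ht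
  · intro bar hbar
    refine Guesswork.computesMinGuesswork hH hbal hσ (by simpa using hbar) hC ?_
      (Guesswork.exists_feasible_conj_ge hH hanti hsum hσ hbar)
    exact Guesswork.card_le_doubleFactorial hbar.2.2 _ subset_rfl _ 0 (by omega) (by simp)
  · intro bar hbar m hm
    -- Needed for the truncated subtraction: |M| = 2·1 + (|M| - 2), where the first letter settles
    -- two times.
    have hcard := hCS.two_le_card hH
    refine Guesswork.computesMinGuesswork hH hbal hσ (by simpa using hbar) hC ?_
      (Guesswork.exists_feasible_conj_first_ge hH hanti hsum hσ htrans hbar hm)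
    exact Guesswork.card_le_doubleFactorial hbar.2.2 _ subset_rfl _ 1 (by omega)
      fun n hn n' hn' t ht => Guesswork.apply_eq_of_mem_feasible_of_val_lt_one hn hn' ht
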